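/- **Setting.** For probability distributions $P,Q$ on a common space, the trade-off function $T[P,Q]:[0,1]\to[0,1]$ is $T[P,Q](\alpha)=\inf\{1-\mathbb E_Q[\phi] : \phi \text{ measurable with values in } [0,1],\ \mathbb E_P[\phi]\le\alpha\}$; a trade-off function is a function of this form. Trade-off functions are compared point-wise (Blackwell order), $\mathrm{Id}(\alpha)=1-\alpha$, and $T[P_1,Q_1]\otimes T[P_2,Q_2]=T[P_1\times P_2,Q_1\times Q_2]$. A mechanism $\mathcal M$ maps a dataset (a finite tuple of datapoints) to a probability distribution; it is $f$-DP if $T[\mathcal M(S),\mathcal M(S^-)]\ge f$ and $T[\mathcal M(S^-),\mathcal M(S)]\ge f$ whenever $S^-$ arises from $S$ by removing one datapoint. Its tight $f$-DP guarantee is the greatest trade-off function $f$ for which it is $f$-DP. A family $\mathcal F$ of trade-off functions is a *Blackwell chain* if any two of its members are comparable. A sequence $f_n$ converges to $g$ in $\Delta$-divergence if the least $\Delta\ge0$ such that $f_n(\alpha+\Delta)-\Delta\le g(\alpha)$ and $g(\alpha+\Delta)-\Delta\le f_n(\alpha)$ for all $\alpha\in[0,1-\Delta]$ tends to $0$. Put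 $\mathcal F^{(\_\otimes)0}=\mathcal F$, and let $\mathcal F^{(\_\otimes)(k+1)}$ be the set of all $f\otimes g$ with $f\in\mathcal F$ and $g$ a trade-off function that is the limit in $\Delta$-divergence of some everywhere decreasing sequence in $\mathcal F^{(\_\otimes)k}$. In a *fully adaptive composition of up to $T$ steps under the natural $f$-DP filter* with budget $f_B$ (any trade-off function), at step $t=1,\dots,T$ a mechanism $\mathcal M_t^{(y_{1:t-1})}$ is chosen depending (measurably) on the earlier outputs, and its tight guarantee $f_t^{(y_{1:t-1})}$ is computed. If $f_1\otimes f_2^{(y_1)}\otimes\cdots\otimes f_t^{(y_{1:t-1})}\ge f_B$, then $y_t\sim\mathcal M_t^{(y_{1:t-1})}(S)$ is drawn and the procedure goes on; otherwise it halts and returns $(y_1,\dots,y_{t-1})$. If it never halts, it returns $(y_1,\dots,y_T)$. The decision to halt is assumed to be a measurable function of the earlier outputs. **Theorem 3.4.** Let $T\ge2$ and let $\mathcal F$ be a family of trade-off functions with $\mathrm{Id}\in\mathcal F$ that contains the tight $f$-DP guarantees of all mechanisms available at each step. If $\mathcal F^{(\_\otimes)(T-2)}$ is a Blackwell chain, then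 the natural $f$-DP filter is valid: for every budget $f_B$, every fully adaptive composition of up to $T$ steps of available mechanisms under the natural filter with budget $f_B$ is $f_B$-DP, as a mechanism that returns the sequence of outputs released before halting. -/

import Mathlib

open MeasureTheory ProbabilityTheory Filter Topology

universe u v

namespace FDP

noncomputable section

/-! ### Trade-off functions -/

/-- The trade-off function `T[P, Q]`: the least false negative rate `1 - E_Q[φ]` over all
randomised rejection rules `φ : Ω → [0, 1]` with false positive rate `E_P[φ] ≤ α`. -/
def tradeoff {Ω : Type*} [MeasurableSpace Ω] (P Q : Measure Ω) (α : unitInterval) : ℝ :=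
  sInf {b : ℝ | ∃ φ : Ω → ℝ, Measurable φ ∧ (∀ y, 0 ≤ φ y ∧ φ y ≤ 1) ∧
    ∫ y, φ y ∂P ≤ (α : ℝ) ∧ b = 1 - ∫ y, φ y ∂Q}

/-- A pair of probability distributions on a common space. -/
structure DistPair where
  Ω : Type
  [mΩ : MeasurableSpace Ω]
  P : Measure Ω
  Q : Measure Ω
  [isProbP : IsProbabilityMeasure P]
  [isProbQ : IsProbabilityMeasure Q]

attribute [instance] DistPair.mΩ DistPair.isProbP DistPair.isProbQ

/-- The pair of product distributions `(P₁ × P₂, Q₁ × Q₂)`. -/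
def DistPair.prod (D E : DistPair) : DistPair where
  Ω := D.Ω × E.Ω
  P := D.P.prod E.P
  Q := D.Q.prod E.Q

/-- Trade-off functions: the functions `[0, 1] → ℝ` of the form `T[P, Q]`. (Up to equality of
trade-off functions it is no restriction to take the sample space in `Type`: every trade-off
function is that of a pair on the unit interval.) The order is the point-wise one, that is, the
Blackwell order. -/
abbrev TradeoffFun : Type :=
  {f : unitInterval → ℝ // ∃ D : DistPair, tradeoff D.P D.Q = f}

/-- Some pair of distributions with trade-off function `f`. -/
def TradeoffFun.pair (f : TradeoffFun) : DistPair := f.2.choose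

theorem TradeoffFun.tradeoff_pair (f : TradeoffFun) :
    tradeoff f.pair.P f.pair.Q = f.1 := f.2.choose_spec

/-- The tensor product `T[P₁, Q₁] ⊗ T[P₂, Q₂] = T[P₁ × P₂, Q₁ × Q₂]`. (The result does not
depend on which pairs represent the two factors.) -/
def TradeoffFun.tensor (f g : TradeoffFun) : TradeoffFun :=
  ⟨tradeoff (f.pair.prod g.pair).P (f.pair.prod g.pair).Q, f.pair.prod g.pair, rfl⟩

/-- The perfectly private trade-off function `Id(α) = 1 - α`. -/
def TradeoffFun.id : TradeoffFun :=
  ⟨fun α => 1 - (α : ℝ), ⟨Unit, Measure.dirac (), Measure.dirac ()⟩, by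
    funext α
    refine IsLeast.csInf_eq ⟨⟨fun _ => (α : ℝ), measurable_const, fun _ => ⟨α.2.1, α.2.2⟩, ?_, ?_⟩,
      ?_⟩
    · simp
    · simp
    · rintro b ⟨φ, -, -, h, rfl⟩
      linarith⟩

/-- The tensor product `f₁ ⊗ … ⊗ f_{t+1}` of a nonempty tuple. -/
def tensorProd : (t : ℕ) → (Fin (t + 1) → TradeoffFun) → TradeoffFun
  | 0, f => f 0
  | t + 1, f => (tensorProd t fun i => f i.castSucc).tensor (f (Fin.last (t + 1)))

/-! ### Blackwell chains and the limit-tensor operation -/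

/-- A Blackwell chain: a family of trade-off functions that is totally ordered point-wise. -/
def IsBlackwellChain (F : Set TradeoffFun) : Prop :=
  ∀ f ∈ F, ∀ g ∈ F, f ≤ g ∨ g ≤ f

/-- The symmetrised `Δ`-divergence: the least `Δ ≥ 0` such that `f (α + Δ) - Δ ≤ g α` and
`g (α + Δ) - Δ ≤ f α` whenever `α` and `α + Δ` both lie in `[0, 1]`. -/
def deltaDiv (f g : TradeoffFun) : ℝ :=
  sInf {Δ : ℝ | 0 ≤ Δ ∧ ∀ α β : unitInterval, (β : ℝ) = α + Δ →
    f.1 β - Δ ≤ g.1 α ∧ g.1 β - Δ ≤ f.1 α}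

/-- The trade-off functions that are limits in `Δ`-divergence of everywhere decreasing sequences
of members of `F`. -/
def decreasingLimits (F : Set TradeoffFun) : Set TradeoffFun :=
  {g | ∃ f : ℕ → TradeoffFun, (∀ n, f n ∈ F) ∧ Antitone f ∧
    Tendsto (fun n => deltaDiv (f n) g) atTop (𝓝 0)}

/-- Iterating `k` times, starting from `F`, the operation "take a limit in `Δ`-divergence of a
decreasing sequence, then tensor with a member of `F`". -/
def limTensorIter (F : Set TradeoffFun) : ℕ → Set TradeoffFun
  | 0 => F
  | k + 1 => {h | ∃ f ∈ F, ∃ g ∈ decreasingLimits (limTensorIter F k), h = f.tensor g}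

/-! ### Mechanisms and `f`-DP

A dataset is a finite tuple of points of `X`; a mechanism with outputs in `Ω` sends every dataset
to a distribution on `Ω`. -/

/-- `S'` is obtained from `S` by removing one datapoint. -/
def RemovePair {X : Type*} (S S' : List X) : Prop :=
  ∃ (l₁ : List X) (x : X) (l₂ : List X), S = l₁ ++ x :: l₂ ∧ S' = l₁ ++ l₂

/-- `M` is `f`-DP. -/
def IsDP {X : Type*} {Ω : Type*} [MeasurableSpace Ω] (M : List X → Measure Ω)
    (f : TradeoffFun) : Prop :=
  ∀ S S' : List X, RemovePair S S' →
    f.1 ≤ tradeoff (M S) (M S') ∧ f.1 ≤ tradeoff (M S') (M S)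

/-- `f` is the tight `f`-DP guarantee of `M`: the greatest trade-off function `f` for which `M`
is `f`-DP. -/
def IsTightGuarantee {X : Type*} {Ω : Type*} [MeasurableSpace Ω] (M : List X → Measure Ω)
    (f : TradeoffFun) : Prop :=
  IsGreatest {g : TradeoffFun | IsDP M g} f

/-! ### Fully adaptive composition with a filter

Steps are numbered from `0`: the step with index `t` is run when the outputs of the `t` earlier
steps are known. -/

/-- The outputs of the first `t` steps. -/
abbrev Hist (O : ℕ → Type v) (t : ℕ) : Type v := (i : Fin t) → O i

/-- Adaptively chosen mechanisms: for every step and every history of earlier outputs a mechanism,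
with output distributions depending measurably on the history. -/
structure AdaptiveMechanisms (X : Type u) (O : ℕ → Type v) [∀ t, MeasurableSpace (O t)] where
  kernel : (t : ℕ) → List X → Kernel (Hist O t) (O t)
  [isMarkov : ∀ t S, IsMarkovKernel (kernel t S)]

attribute [instance] AdaptiveMechanisms.isMarkov

section Composition

variable {X : Type u} {O : ℕ → Type v} [∀ t, MeasurableSpace (O t)]

/-- The mechanism run at the step with index `t` after the outputs `h`. -/
def AdaptiveMechanisms.mechanism (M : AdaptiveMechanisms X O) (t : ℕ) (h : Hist O t) :
    List X → Measure (O t) :=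
  fun S => M.kernel t S h

/-- The privacy levels of the steps with index `0, …, t` along the history `h`, where `f i` gives
the level of the step with index `i` as a function of the outputs of the earlier steps. -/
def realisedLevels (f : (t : ℕ) → Hist O t → TradeoffFun) {t : ℕ} (h : Hist O t) :
    Fin (t + 1) → TradeoffFun :=
  fun i => f i fun j => h ⟨j, lt_of_lt_of_le j.2 (Nat.lt_succ_iff.1 i.2)⟩

/-- The natural filter with budget `fB` continues (`CONT`) on the levels `ω` iff the tensor
product of the levels is at least `fB`; otherwise it halts. -/
def naturalFilter (fB : TradeoffFun) (t : ℕ) (ω : Fin (t + 1) → TradeoffFun) : Prop :=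
  fB ≤ tensorProd t ω

/-- What the composition returns: the outputs of the steps that were run. -/
abbrev Transcript (O : ℕ → Type v) : Type v := (k : ℕ) × Hist O k

open Classical in
/-- The law of the returned transcript on the dataset `S` when the outputs `h` of the first `t`
steps are known and at most `n` further steps are run: the filter `filt` is asked with the levels
up to and including the upcoming step; if it halts, `h` is returned, otherwise the step is run and
the procedure goes on. -/
def runFrom (M : AdaptiveMechanisms X O) (f : (t : ℕ) → Hist O t → TradeoffFun)
    (filt : (t : ℕ) → (Fin (t + 1) → TradeoffFun) → Prop) (S : List X) :
    ℕ → (t : ℕ) → Hist O t → Measure (Transcript O)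
  | 0, t, h => Measure.dirac ⟨t, h⟩
  | n + 1, t, h =>
    if filt t (realisedLevels f h) then
      (M.kernel t S h).bind fun y =>
        runFrom M f filt S n (t + 1) (Fin.snoc (α := fun i : Fin (t + 1) => O i) h y)
    else Measure.dirac ⟨t, h⟩

/-- The fully adaptive composition of up to `T` steps under the filter `filt`, as a mechanism. -/
def filteredComposition (M : AdaptiveMechanisms X O) (f : (t : ℕ) → Hist O t → TradeoffFun)
    (filt : (t : ℕ) → (Fin (t + 1) → TradeoffFun) → Prop) (T : ℕ) :
    List X → Measure (Transcript O) :=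
  fun S => runFrom M f filt S T 0 fun i => i.elim0

/-- The decisions of the filter depend measurably on the outputs. -/
def MeasurableDecisions (f : (t : ℕ) → Hist O t → TradeoffFun)
    (filt : (t : ℕ) → (Fin (t + 1) → TradeoffFun) → Prop) (T : ℕ) : Prop :=
  ∀ t < T, MeasurableSet {h : Hist O t | filt t (realisedLevels f h)}

end Composition

end

end FDP

namespace FDP

noncomputable section

/-! ### Tests and the trade-off function -/

/-! The proof is a backward induction over the steps, for one fixed ordered pair of neighbouring
datasets. After a history `h` that used up `prefixProd f t h`, with `k + 1` steps to go, one wants a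
single `r` in the `k`-th iterated family that bounds the privacy of the rest from below and still
satisfies `fB ≤ prefixProd f t h ⊗ r`. If the filter halts, `r = Id` works.

If it continues, each next output `y` gives its own guarantee for the rest. All of them lie in the
set `C` of those `r` in the previous family for which prefix, current level and `r` together respect
the budget, and `C` does not depend on `y`. Being part of a chain, `C` contains a decreasing
sequence whose `Δ`-limit `g` is a lower bound of all of `C`
(`IsBlackwellChain.exists_decreasing_limit`). Tensoring is continuous for this convergence, so `g`
respects the budget as well (`le_tensor_of_tendsto`), even though it may lie outside the family.
Since `g` is a uniform guarantee for the rest, adaptive composition (`tensor_le_tradeoff_bind`)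
gives `f t h ⊗ g`, a member of the next family.

The analytic tool is duality: trade-off functions are compared exactly as hockey-stick divergences
are, and these integrate fibrewise over products. The form with two weights is needed because
passing to the fibre over `y` multiplies the weights by the densities at `y`. That the limit is a
trade-off function follows from realising every function of the right shape by the uniform law and
the law with distribution function `1 - f`. -/

/-- A randomised rejection rule. -/
structure IsTest {Ω : Type*} [MeasurableSpace Ω] (φ : Ω → ℝ) : Prop where
  measurable : Measurable φ
  nonneg : ∀ y, 0 ≤ φ y
  le_one : ∀ y, φ y ≤ 1

section Tests

variable {Ω Ω' : Type*} [MeasurableSpace Ω] [MeasurableSpace Ω']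

theorem isTest_const {c : ℝ} (h0 : 0 ≤ c) (h1 : c ≤ 1) : IsTest (fun _ : Ω => c) :=
  ⟨measurable_const, fun _ => h0, fun _ => h1⟩

theorem IsTest.comp {φ : Ω' → ℝ} (hφ : IsTest φ) {e : Ω → Ω'} (he : Measurable e) :
    IsTest (fun y => φ (e y)) :=
  ⟨hφ.measurable.comp he, fun _ => hφ.nonneg _, fun _ => hφ.le_one _⟩

theorem IsTest.integrable {φ : Ω → ℝ} (hφ : IsTest φ) (P : Measure Ω) [IsFiniteMeasure P] :
    Integrable φ P :=
  Integrable.of_bound hφ.measurable.aestronglyMeasurable 1 (Eventually.of_forall fun y => by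
    rw [Real.norm_eq_abs, abs_of_nonneg (hφ.nonneg y)]; exact hφ.le_one y)

theorem IsTest.integral_nonneg {φ : Ω → ℝ} (hφ : IsTest φ) (P : Measure Ω) : 0 ≤ ∫ y, φ y ∂P :=
  MeasureTheory.integral_nonneg hφ.nonneg

theorem IsTest.integral_le_one {φ : Ω → ℝ} (hφ : IsTest φ) (P : Measure Ω)
    [IsProbabilityMeasure P] : ∫ y, φ y ∂P ≤ 1 := by
  have := integral_mono (hφ.integrable P) (integrable_const (1 : ℝ)) hφ.le_one
  simpa using this

theorem IsTest.mix {φ ψ : Ω → ℝ} (hφ : IsTest φ) (hψ : IsTest ψ) {s t : ℝ} (hs : 0 ≤ s)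
    (ht : 0 ≤ t) (hst : s + t = 1) : IsTest (fun y => s * φ y + t * ψ y) where
  measurable := (hφ.measurable.const_mul s).add (hψ.measurable.const_mul t)
  nonneg y := add_nonneg (mul_nonneg hs (hφ.nonneg y)) (mul_nonneg ht (hψ.nonneg y))
  le_one y := by nlinarith [hφ.le_one y, hψ.le_one y]

theorem tradeoff_le (P Q : Measure Ω) [IsProbabilityMeasure Q] {φ : Ω → ℝ}
    (hφ : IsTest φ) {α : unitInterval} (h : ∫ y, φ y ∂P ≤ (α : ℝ)) : tradeoff P Q α ≤ 1 - ∫ y, φ y ∂Q := by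
  refine csInf_le ⟨0, ?_⟩ ⟨φ, hφ.measurable, fun y => ⟨hφ.nonneg y, hφ.le_one y⟩, h, rfl⟩
  rintro b ⟨ψ, hψ, h1, -, rfl⟩
  have := IsTest.integral_le_one ⟨hψ, fun y => (h1 y).1, fun y => (h1 y).2⟩ Q
  linarith

theorem le_tradeoff (P Q : Measure Ω) {α : unitInterval} {b : ℝ}
    (h : ∀ φ : Ω → ℝ, IsTest φ → ∫ y, φ y ∂P ≤ (α : ℝ) → b ≤ 1 - ∫ y, φ y ∂Q) :
    b ≤ tradeoff P Q α := by
  refine le_csInf ⟨1, fun _ => 0, measurable_const, by simp, by simpa using α.2.1, by simp⟩ ?_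
  rintro _ ⟨ψ, hψ, h1, h2, rfl⟩
  exact h ψ ⟨hψ, fun y => (h1 y).1, fun y => (h1 y).2⟩ h2

theorem exists_test_lt (P Q : Measure Ω) {α : unitInterval} {b : ℝ} (h : tradeoff P Q α < b) :
    ∃ φ : Ω → ℝ, IsTest φ ∧ ∫ y, φ y ∂P ≤ (α : ℝ) ∧ 1 - ∫ y, φ y ∂Q < b := by
  by_contra! hc
  exact absurd (le_tradeoff P Q (b := b) fun φ h1 h2 => hc φ h1 h2) (not_le.2 h)

theorem tradeoff_nonneg (P Q : Measure Ω) [IsProbabilityMeasure Q] (α : unitInterval) :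
    0 ≤ tradeoff P Q α :=
  le_tradeoff P Q fun φ hφ _ => by linarith [hφ.integral_le_one Q]

variable (P Q : Measure Ω) [IsProbabilityMeasure P] [IsProbabilityMeasure Q]

theorem tradeoff_le_one_sub (α : unitInterval) : tradeoff P Q α ≤ 1 - α := by
  have := tradeoff_le P Q (isTest_const (Ω := Ω) α.2.1 α.2.2) (α := α) (by simp)
  simpa using this

theorem tradeoff_antitone (P Q : Measure Ω) [IsProbabilityMeasure Q] :
    Antitone (tradeoff P Q) := fun _ _ hαβ =>
  le_tradeoff P Q fun _ hφ h => tradeoff_le P Q hφ (h.trans hαβ)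

theorem tradeoff_convex {α β γ : unitInterval} {s t : ℝ} (hs : 0 ≤ s) (ht : 0 ≤ t)
    (hst : s + t = 1) (hγ : (γ : ℝ) = s * α + t * β) :
    tradeoff P Q γ ≤ s * tradeoff P Q α + t * tradeoff P Q β := by
  refine le_of_forall_pos_le_add fun ε hε => ?_
  obtain ⟨φ, hφ, h1, h2⟩ := exists_test_lt P Q (lt_add_of_pos_right (tradeoff P Q α) hε)
  obtain ⟨ψ, hψ, h3, h4⟩ := exists_test_lt P Q (lt_add_of_pos_right (tradeoff P Q β) hε)
  have key : ∀ ν : Measure Ω, [IsProbabilityMeasure ν] →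
      ∫ y, (s * φ y + t * ψ y) ∂ν = s * ∫ y, φ y ∂ν + t * ∫ y, ψ y ∂ν := fun ν _ => by
    rw [integral_add ((hφ.integrable ν).const_mul s) ((hψ.integrable ν).const_mul t),
      integral_const_mul, integral_const_mul]
  have := tradeoff_le P Q (hφ.mix hψ hs ht hst) (α := γ) (by
    rw [key, hγ]; gcongr)
  rw [key] at this
  nlinarith [mul_le_mul_of_nonneg_left h2.le hs, mul_le_mul_of_nonneg_left h4.le ht]

theorem tradeoff_map_ge {e : Ω → Ω'} (he : Measurable e) :
    tradeoff P Q ≤ tradeoff (P.map e) (Q.map e) := by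
  have : IsProbabilityMeasure (P.map e) := Measure.isProbabilityMeasure_map he.aemeasurable
  have : IsProbabilityMeasure (Q.map e) := Measure.isProbabilityMeasure_map he.aemeasurable
  refine fun α => le_tradeoff _ _ fun φ hφ h => ?_
  rw [integral_map he.aemeasurable hφ.measurable.aestronglyMeasurable] at h ⊢
  exact tradeoff_le P Q (hφ.comp he) h

theorem tradeoff_self : tradeoff P P = TradeoffFun.id.1 := by
  funext α
  refine le_antisymm (tradeoff_le_one_sub P P α) (le_tradeoff P P fun φ _ h => ?_)
  change 1 - (α : ℝ) ≤ _
  linarith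

end Tests

/-! ### Hockey-stick divergences -/

/-- The two-parameter hockey-stick divergence `sup_φ (a E_Q[φ] - b E_P[φ])`. -/
def hockey {Ω : Type*} [MeasurableSpace Ω] (P Q : Measure Ω) (a b : ℝ) : ℝ :=
  sSup {x : ℝ | ∃ φ : Ω → ℝ, IsTest φ ∧ x = a * ∫ y, φ y ∂Q - b * ∫ y, φ y ∂P}

section Hockey

variable {Ω Ω' : Type*} [MeasurableSpace Ω] [MeasurableSpace Ω']

theorem hockey_le {P Q : Measure Ω} {a b s : ℝ}
    (h : ∀ φ : Ω → ℝ, IsTest φ → a * ∫ y, φ y ∂Q - b * ∫ y, φ y ∂P ≤ s) : hockey P Q a b ≤ s := by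
  refine csSup_le ⟨_, fun _ => 0, isTest_const le_rfl zero_le_one, rfl⟩ ?_
  rintro _ ⟨φ, hφ, rfl⟩
  exact h φ hφ

theorem le_hockey (P Q : Measure Ω) [IsProbabilityMeasure P] [IsProbabilityMeasure Q] {a b : ℝ}
    (ha : 0 ≤ a) (hb : 0 ≤ b) {φ : Ω → ℝ} (hφ : IsTest φ) :
    a * ∫ y, φ y ∂Q - b * ∫ y, φ y ∂P ≤ hockey P Q a b := by
  refine le_csSup ⟨a, ?_⟩ ⟨φ, hφ, rfl⟩
  rintro _ ⟨ψ, hψ, rfl⟩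
  nlinarith [hψ.integral_le_one Q, hψ.integral_nonneg P]

/-- An approximate comparison of trade-off functions gives an approximate comparison of
hockey-stick divergences. -/
theorem hockey_le_of_tradeoff (P Q : Measure Ω) [IsProbabilityMeasure P] [IsProbabilityMeasure Q]
    (P' Q' : Measure Ω') [IsProbabilityMeasure P'] [IsProbabilityMeasure Q'] {δ : ℝ}
    (hδ : 0 ≤ δ)
    (h : ∀ α β : unitInterval, (β : ℝ) = α + δ → tradeoff P' Q' β - δ ≤ tradeoff P Q α)
    {a b : ℝ} (ha : 0 ≤ a) (hb : 0 ≤ b) :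
    hockey P Q a b ≤ hockey P' Q' a b + (a + b) * δ := by
  refine hockey_le fun φ hφ => ?_
  by_cases hle : ∫ y, φ y ∂P + δ ≤ 1
  · set α : unitInterval := ⟨∫ y, φ y ∂P, hφ.integral_nonneg P, hφ.integral_le_one P⟩
    set β : unitInterval := ⟨∫ y, φ y ∂P + δ, add_nonneg (hφ.integral_nonneg P) hδ, hle⟩
    have h1 := h α β rfl
    have h2 : tradeoff P Q α ≤ 1 - ∫ y, φ y ∂Q := tradeoff_le P Q hφ le_rfl
    refine le_of_forall_pos_le_add fun ε hε => ?_
    -- Dividing by `a + 1` rather than `a` keeps the slack meaningful when `a = 0`.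
    obtain ⟨ψ, hψ, h3, h4⟩ := exists_test_lt P' Q'
      (b := tradeoff P' Q' β + ε / (a + 1)) (lt_add_of_pos_right _ (by positivity))
    have h5 := le_hockey P' Q' ha hb hψ
    have h6 : a * (ε / (a + 1)) ≤ ε := by
      rw [mul_div_assoc', div_le_iff₀ (by positivity)]; nlinarith
    have h7 : (∫ y, ψ y ∂P') ≤ ∫ y, φ y ∂P + δ := h3
    have h8 : (∫ y, φ y ∂Q) ≤ ∫ y, ψ y ∂Q' + δ + ε / (a + 1) := by linarith
    nlinarith [mul_le_mul_of_nonneg_left h7 hb, mul_le_mul_of_nonneg_left h8 ha]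
  -- Here `E_P[φ] > 1 - δ`, so `φ` gains at most `a - b + b δ`, and the constant test `1` already
  -- achieves `a - b`.
  · have h5 := le_hockey P' Q' ha hb (isTest_const (Ω := Ω') zero_le_one le_rfl)
    simp only [integral_const, probReal_univ, smul_eq_mul, mul_one] at h5
    nlinarith [hφ.integral_le_one Q, mul_le_mul_of_nonneg_left (not_le.1 hle).le hb,
      mul_le_mul_of_nonneg_left (hφ.integral_le_one Q) ha, mul_nonneg ha hδ]

/-- Any two probability measures have finite densities with respect to a finite measure. -/
theorem exists_densities (P Q : Measure Ω) [IsProbabilityMeasure P] [IsProbabilityMeasure Q] :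
    ∃ μ : Measure Ω, IsFiniteMeasure μ ∧ ∃ p q : Ω → NNReal, Measurable p ∧ Measurable q ∧
      P = μ.withDensity (fun y => (p y : ENNReal)) ∧
      Q = μ.withDensity (fun y => (q y : ENNReal)) := by
  have key : ∀ R μ : Measure Ω, [IsFiniteMeasure R] → [IsFiniteMeasure μ] → R ≪ μ →
      R = μ.withDensity (fun y => ((R.rnDeriv μ y).toNNReal : ENNReal)) := by
    intro R μ _ _ h
    conv_lhs => rw [← Measure.withDensity_rnDeriv_eq R μ h]
    refine withDensity_congr_ae ?_
    filter_upwards [Measure.rnDeriv_lt_top R μ] with y hy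
    exact (ENNReal.coe_toNNReal hy.ne).symm
  refine ⟨P + Q, inferInstance, fun y => (P.rnDeriv (P + Q) y).toNNReal,
    fun y => (Q.rnDeriv (P + Q) y).toNNReal, (Measure.measurable_rnDeriv _ _).ennreal_toNNReal,
    (Measure.measurable_rnDeriv _ _).ennreal_toNNReal, key _ _ ?_, key _ _ ?_⟩
  · exact Measure.absolutelyContinuous_of_le (Measure.le_add_right le_rfl)
  · exact Measure.absolutelyContinuous_of_le (Measure.le_add_left le_rfl)

variable {μ : Measure Ω} {p q : Ω → NNReal}

theorem integral_density (hp : Measurable p) (φ : Ω → ℝ) :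
    ∫ y, φ y ∂(μ.withDensity fun y => (p y : ENNReal)) = ∫ y, (p y : ℝ) * φ y ∂μ := by
  rw [integral_withDensity_eq_integral_smul hp]; rfl

theorem integrable_density_mul (hp : Measurable p)
    [IsFiniteMeasure (μ.withDensity fun y => (p y : ENNReal))] {φ : Ω → ℝ} (hφ : IsTest φ) :
    Integrable (fun y => (p y : ℝ) * φ y) μ :=
  (integrable_withDensity_iff_integrable_smul hp).1 (hφ.integrable _)

theorem integrable_density (hp : Measurable p)
    [IsFiniteMeasure (μ.withDensity fun y => (p y : ENNReal))] :
    Integrable (fun y => (p y : ℝ)) μ := by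
  simpa using integrable_density_mul (μ := μ) hp (isTest_const (Ω := Ω) zero_le_one le_rfl)

/-- Neyman–Pearson: the supremum is attained by the indicator of `{a q ≥ b p}`. -/
theorem hockey_eq_integral {P Q : Measure Ω} [IsProbabilityMeasure P] [IsProbabilityMeasure Q]
    (hp : Measurable p) (hq : Measurable q)
    (hP : P = μ.withDensity (fun y => (p y : ENNReal)))
    (hQ : Q = μ.withDensity (fun y => (q y : ENNReal))) {a b : ℝ} (ha : 0 ≤ a) (hb : 0 ≤ b) :
    hockey P Q a b = ∫ y, max (a * q y - b * p y) 0 ∂μ := by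
  have iP : IsFiniteMeasure (μ.withDensity fun y => (p y : ENNReal)) := hP ▸ inferInstance
  have iQ : IsFiniteMeasure (μ.withDensity fun y => (q y : ENNReal)) := hQ ▸ inferInstance
  have key : ∀ φ : Ω → ℝ, IsTest φ → a * ∫ y, φ y ∂Q - b * ∫ y, φ y ∂P =
      ∫ y, (a * q y - b * p y) * φ y ∂μ := fun φ hφ => by
    rw [hP, hQ, integral_density hp, integral_density hq, ← integral_const_mul,
      ← integral_const_mul, ← integral_sub ((integrable_density_mul hq hφ).const_mul a)
        ((integrable_density_mul hp hφ).const_mul b)]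
    congr 1; funext y; ring
  have hint : Integrable (fun y => a * (q y : ℝ) - b * p y) μ :=
    ((integrable_density hq).const_mul a).sub ((integrable_density hp).const_mul b)
  refine le_antisymm (hockey_le fun φ hφ => ?_) ?_
  · rw [key φ hφ]
    refine integral_mono (hint.mul_bdd (c := 1) hφ.measurable.aestronglyMeasurable
      (Eventually.of_forall fun y => ?_)) hint.pos_part fun y => ?_
    · rw [Real.norm_eq_abs, abs_of_nonneg (hφ.nonneg y)]; exact hφ.le_one y
    · rcases le_total 0 (a * (q y : ℝ) - b * p y) with h | h
      · exact (mul_le_of_le_one_right h (hφ.le_one y)).trans (le_max_left _ _)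
      · exact (mul_nonpos_of_nonpos_of_nonneg h (hφ.nonneg y)).trans (le_max_right _ _)
  · set s : Set Ω := {y | 0 ≤ a * (q y : ℝ) - b * p y} with hs
    have hsm : MeasurableSet s := measurableSet_le measurable_const
      ((hq.coe_nnreal_real.const_mul a).sub (hp.coe_nnreal_real.const_mul b))
    have ht : IsTest (s.indicator fun _ => (1 : ℝ)) :=
      ⟨measurable_const.indicator hsm, fun y => Set.indicator_nonneg (fun _ _ => zero_le_one) y,
        fun y => Set.indicator_le_self' (fun _ _ => zero_le_one) y⟩
    refine le_trans (le_of_eq ?_) (le_hockey P Q ha hb ht)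
    rw [key _ ht]
    congr 1; funext y
    by_cases hy : y ∈ s
    · rw [Set.indicator_of_mem hy, mul_one, max_eq_left hy]
    · rw [Set.indicator_of_notMem hy, mul_zero, max_eq_right (not_le.1 hy).le]

/-- Hockey-stick divergence of a product, computed fibrewise. -/
theorem hockey_prod (P Q : Measure Ω) [IsProbabilityMeasure P] [IsProbabilityMeasure Q]
    (P' Q' : Measure Ω') [IsProbabilityMeasure P'] [IsProbabilityMeasure Q'] [SFinite μ]
    (hp : Measurable p) (hq : Measurable q)
    (hP : P = μ.withDensity (fun y => (p y : ENNReal)))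
    (hQ : Q = μ.withDensity (fun y => (q y : ENNReal))) {a b : ℝ} (ha : 0 ≤ a) (hb : 0 ≤ b) :
    Integrable (fun y => hockey P' Q' (a * q y) (b * p y)) μ ∧
    hockey (P.prod P') (Q.prod Q') a b = ∫ y, hockey P' Q' (a * q y) (b * p y) ∂μ := by
  obtain ⟨ν, _, p', q', hp', hq', hP', hQ'⟩ := exists_densities P' Q'
  have hpp : Measurable fun z : Ω × Ω' => p z.1 * p' z.2 :=
    (hp.comp measurable_fst).mul (hp'.comp measurable_snd)
  have hqq : Measurable fun z : Ω × Ω' => q z.1 * q' z.2 :=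
    (hq.comp measurable_fst).mul (hq'.comp measurable_snd)
  have hPP : P.prod P' = (μ.prod ν).withDensity
      (fun z => ((p z.1 * p' z.2 : NNReal) : ENNReal)) := by
    have : SFinite (μ.withDensity fun y => (p y : ENNReal)) := hP ▸ inferInstance
    have : SFinite (ν.withDensity fun y => (p' y : ENNReal)) := hP' ▸ inferInstance
    simp only [ENNReal.coe_mul]
    rw [hP, hP', prod_withDensity hp.coe_nnreal_ennreal hp'.coe_nnreal_ennreal]
  have hQQ : Q.prod Q' = (μ.prod ν).withDensity
      (fun z => ((q z.1 * q' z.2 : NNReal) : ENNReal)) := by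
    have : SFinite (μ.withDensity fun y => (q y : ENNReal)) := hQ ▸ inferInstance
    have : SFinite (ν.withDensity fun y => (q' y : ENNReal)) := hQ' ▸ inferInstance
    simp only [ENNReal.coe_mul]
    rw [hQ, hQ', prod_withDensity hq.coe_nnreal_ennreal hq'.coe_nnreal_ennreal]
  have iP : IsFiniteMeasure ((μ.prod ν).withDensity
    fun z => ((p z.1 * p' z.2 : NNReal) : ENNReal)) := hPP ▸ inferInstance
  have iQ : IsFiniteMeasure ((μ.prod ν).withDensity
    fun z => ((q z.1 * q' z.2 : NNReal) : ENNReal)) := hQQ ▸ inferInstance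
  have hint : Integrable (fun z : Ω × Ω' => max (a * ((q z.1 * q' z.2 : NNReal) : ℝ) -
      b * ((p z.1 * p' z.2 : NNReal) : ℝ)) 0) (μ.prod ν) :=
    (((integrable_density hqq).const_mul a).sub ((integrable_density hpp).const_mul b)).pos_part
  have heq : (fun y => hockey P' Q' (a * q y) (b * p y)) = fun y => ∫ z, max (a *
      ((q y * q' z : NNReal) : ℝ) - b * ((p y * p' z : NNReal) : ℝ)) 0 ∂ν := by
    funext y
    rw [hockey_eq_integral hp' hq' hP' hQ' (by positivity) (by positivity)]
    simp only [NNReal.coe_mul, mul_assoc]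
  rw [heq]
  exact ⟨hint.integral_prod_left, by
    rw [hockey_eq_integral hpp hqq hPP hQQ ha hb, integral_prod _ hint]⟩

/-- Fibrewise bounds by the hockey-stick divergence of `(P', Q')`, up to a slack, integrate to a
bound by that of the product. -/
theorem le_hockey_prod (P Q : Measure Ω) [IsProbabilityMeasure P] [IsProbabilityMeasure Q]
    (P' Q' : Measure Ω') [IsProbabilityMeasure P'] [IsProbabilityMeasure Q'] {δ : ℝ}
    {φ ψ : Ω → ℝ} (hφ : IsTest φ) (hψ : IsTest ψ)
    (h : ∀ y, ∀ a b : ℝ, 0 ≤ a → 0 ≤ b → a * ψ y - b * φ y ≤ hockey P' Q' a b + (a + b) * δ)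
    {a b : ℝ} (ha : 0 ≤ a) (hb : 0 ≤ b) :
    a * ∫ y, ψ y ∂Q - b * ∫ y, φ y ∂P ≤ hockey (P.prod P') (Q.prod Q') a b + (a + b) * δ := by
  obtain ⟨μ, _, p, q, hp, hq, hP, hQ⟩ := exists_densities P Q
  have iP : IsFiniteMeasure (μ.withDensity fun y => (p y : ENNReal)) := hP ▸ inferInstance
  have iQ : IsFiniteMeasure (μ.withDensity fun y => (q y : ENNReal)) := hQ ▸ inferInstance
  obtain ⟨hint, heq⟩ := hockey_prod P Q P' Q' hp hq hP hQ ha hb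
  have hp1 : ∫ y, (p y : ℝ) ∂μ = 1 := by
    simpa [← hP] using (integral_density (μ := μ) hp fun _ => 1).symm
  have hq1 : ∫ y, (q y : ℝ) ∂μ = 1 := by
    simpa [← hQ] using (integral_density (μ := μ) hq fun _ => 1).symm
  have e1 : Integrable (fun y => a * ((q y : ℝ) * ψ y)) μ :=
    (integrable_density_mul hq hψ).const_mul a
  have e2 : Integrable (fun y => b * ((p y : ℝ) * φ y)) μ :=
    (integrable_density_mul hp hφ).const_mul b
  have e3 : Integrable (fun y => a * (q y : ℝ)) μ := (integrable_density hq).const_mul a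
  have e4 : Integrable (fun y => b * (p y : ℝ)) μ := (integrable_density hp).const_mul b
  have e5 : Integrable (fun y => (a * (q y : ℝ) + b * p y) * δ) μ := (e3.add e4).mul_const δ
  calc a * ∫ y, ψ y ∂Q - b * ∫ y, φ y ∂P
      = ∫ y, (a * ((q y : ℝ) * ψ y) - b * ((p y : ℝ) * φ y)) ∂μ := by
        rw [integral_sub e1 e2, integral_const_mul, integral_const_mul, ← integral_density hq,
          ← integral_density hp, ← hP, ← hQ]
    _ ≤ ∫ y, (hockey P' Q' (a * q y) (b * p y) + (a * q y + b * p y) * δ) ∂μ := by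
        refine integral_mono (e1.sub e2) (hint.add e5) fun y => ?_
        have := h y (a * q y) (b * p y) (by positivity) (by positivity)
        simpa only [mul_assoc] using this
    _ = hockey (P.prod P') (Q.prod Q') a b + (a + b) * δ := by
        rw [integral_add hint e5, integral_mul_const, integral_add e3 e4,
          integral_const_mul, integral_const_mul, hp1, hq1, heq, mul_one, mul_one]

end Hockey

/-! ### Shape of trade-off functions -/

/-- The characteristic properties of trade-off functions. -/
structure IsTradeoffShape (f : unitInterval → ℝ) : Prop where
  nonneg : ∀ α, 0 ≤ f α
  le_one_sub : ∀ α, f α ≤ 1 - (α : ℝ)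
  antitone : Antitone f
  convex : ∀ α β γ : unitInterval, ∀ s t : ℝ, 0 ≤ s → 0 ≤ t → s + t = 1 →
    (γ : ℝ) = s * α + t * β → f γ ≤ s * f α + t * f β
  right_cont_zero : ∀ ε > 0, ∃ α : unitInterval, 0 < α ∧ f 0 ≤ f α + ε

/-- The slope is the infimum of the left difference quotients at `α`, which by convexity dominates
every right one. Positivity of `α` makes this set nonempty; at `0` the slope may be infinite. -/
theorem IsTradeoffShape.exists_support {f : unitInterval → ℝ} (hf : IsTradeoffShape f)
    {α : unitInterval} (hα : 0 < α) :
    ∃ c : ℝ, 0 ≤ c ∧ ∀ β : unitInterval, f α + c * ((α : ℝ) - β) ≤ f β := by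
  set S : Set ℝ := {x | ∃ β : unitInterval, β < α ∧ x = (f β - f α) / ((α : ℝ) - β)} with hS
  have hne : S.Nonempty := ⟨_, 0, hα, rfl⟩
  have hnn : ∀ x ∈ S, 0 ≤ x := by
    rintro _ ⟨β, hβ, rfl⟩
    have h1 : (β : ℝ) < α := hβ
    exact div_nonneg (sub_nonneg.2 (hf.antitone hβ.le)) (by linarith)
  refine ⟨sInf S, Real.sInf_nonneg hnn, fun β => ?_⟩
  rcases lt_trichotomy β α with h | rfl | h
  · have h1 : (β : ℝ) < α := h
    have h2 : sInf S ≤ (f β - f α) / ((α : ℝ) - β) := csInf_le ⟨0, hnn⟩ ⟨β, h, rfl⟩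
    rw [le_div_iff₀ (by linarith)] at h2
    linarith
  · simp
  · have h1 : (α : ℝ) < β := h
    have h2 : (f α - f β) / ((β : ℝ) - α) ≤ sInf S := by
      refine le_csInf hne ?_
      rintro _ ⟨γ, hγ, rfl⟩
      have h3 : (γ : ℝ) < α := hγ
      have h4 := hf.convex γ β α ((β - α) / (β - γ)) ((α - γ) / (β - γ))
        (div_nonneg (by linarith) (by linarith)) (div_nonneg (by linarith) (by linarith))
        (by field_simp [show (β : ℝ) - γ ≠ 0 by linarith]; ring)
        (by field_simp [show (β : ℝ) - γ ≠ 0 by linarith]; ring)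
      have h5 : 0 < (β : ℝ) - γ := by linarith
      rw [div_mul_eq_mul_div, div_mul_eq_mul_div, ← add_div, le_div_iff₀ h5] at h4
      rw [div_le_div_iff₀ (by linarith) (by linarith)]
      nlinarith
    rw [div_le_iff₀ (by linarith)] at h2
    linarith

section

variable {Ω Ω' : Type*} [MeasurableSpace Ω] [MeasurableSpace Ω']

/-- Rejecting on `{p = 0}` costs no false positives. Any test has `E_Q[φ] ≤ hockey P Q 1 n + n
E_P[φ]`, and the divergence tends to `Q(p = 0)` as `n` grows, so a tiny level gains little over that
test. -/
theorem tradeoff_right_cont_zero (P Q : Measure Ω) [IsProbabilityMeasure P]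
    [IsProbabilityMeasure Q] {ε : ℝ} (hε : 0 < ε) :
    ∃ α : unitInterval, 0 < α ∧ tradeoff P Q 0 ≤ tradeoff P Q α + ε := by
  obtain ⟨μ, _, p, q, hp, hq, hP, hQ⟩ := exists_densities P Q
  have iP : IsFiniteMeasure (μ.withDensity fun y => (p y : ENNReal)) := hP ▸ inferInstance
  have iQ : IsFiniteMeasure (μ.withDensity fun y => (q y : ENNReal)) := hQ ▸ inferInstance
  set s : Set Ω := {y | p y = 0} with hs
  have hsm : MeasurableSet s := hp (measurableSet_singleton 0)
  have ht : IsTest (s.indicator fun _ => (1 : ℝ)) :=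
    ⟨measurable_const.indicator hsm, fun y => Set.indicator_nonneg (fun _ _ => zero_le_one) y,
      fun y => Set.indicator_le_self' (fun _ _ => zero_le_one) y⟩
  have hlim : Tendsto (fun n : ℕ => hockey P Q 1 n) atTop
      (𝓝 (∫ y, s.indicator (fun _ => (1 : ℝ)) y ∂Q)) := by
    have e : ∀ n : ℕ, hockey P Q 1 n = ∫ y, max (1 * (q y : ℝ) - n * p y) 0 ∂μ := fun n =>
      hockey_eq_integral hp hq hP hQ zero_le_one n.cast_nonneg
    simp only [e]
    rw [hQ, integral_density hq]
    refine tendsto_integral_of_dominated_convergence (fun y => (q y : ℝ)) (fun n => ?_)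
      (integrable_density hq) (fun n => Eventually.of_forall fun y => ?_)
      (Eventually.of_forall fun y => ?_)
    · exact (((hq.coe_nnreal_real.const_mul 1).sub
        (hp.coe_nnreal_real.const_mul (n : ℝ))).max measurable_const).aestronglyMeasurable
    · rw [Real.norm_eq_abs, abs_of_nonneg (le_max_right _ _)]
      refine max_le ?_ (q y).2
      have : (0 : ℝ) ≤ n * p y := by positivity
      linarith
    · by_cases hy : y ∈ s
      · have h0 : p y = 0 := hy
        simp [Set.indicator_of_mem hy, h0]
      · rw [Set.indicator_of_notMem hy, mul_zero]
        have h0 : (0 : ℝ) < p y := NNReal.coe_pos.2 (pos_iff_ne_zero.2 hy)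
        obtain ⟨N, hN⟩ := exists_nat_ge ((q y : ℝ) / p y)
        refine tendsto_const_nhds.congr' ?_
        filter_upwards [eventually_ge_atTop N] with n hn
        rw [div_le_iff₀ h0] at hN
        have : (N : ℝ) * p y ≤ n * p y := by gcongr
        exact (max_eq_right (by linarith)).symm
  have h0 : tradeoff P Q 0 ≤ 1 - ∫ y, s.indicator (fun _ => (1 : ℝ)) y ∂Q := by
    refine tradeoff_le P Q ht (le_of_eq ?_)
    rw [hP, integral_density hp]
    refine (integral_congr_ae (Eventually.of_forall fun y => ?_)).trans (integral_zero _ _)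
    by_cases hy : y ∈ s
    · have h0 : p y = 0 := hy
      simp [h0]
    · simp [Set.indicator_of_notMem hy]
  obtain ⟨N, hN⟩ := (hlim.eventually (gt_mem_nhds
    (lt_add_of_pos_right _ (half_pos hε)))).exists
  have hmem : min 1 (ε / 2 / (N + 1)) ∈ Set.Icc (0 : ℝ) 1 :=
    ⟨by positivity, min_le_left _ _⟩
  refine ⟨⟨_, hmem⟩, Subtype.coe_lt_coe.1 (show (0 : ℝ) < min 1 (ε / 2 / (N + 1)) by positivity), ?_⟩
  refine tsub_le_iff_right.1 (le_tradeoff P Q fun φ hφ hφα => ?_)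
  have h1 := le_hockey P Q zero_le_one (N.cast_nonneg) hφ
  have h2 : ∫ y, φ y ∂P ≤ ε / 2 / (N + 1) := hφα.trans (min_le_right _ _)
  rw [le_div_iff₀ (by positivity)] at h2
  nlinarith [hφ.integral_nonneg P]

theorem isTradeoffShape_tradeoff (P Q : Measure Ω) [IsProbabilityMeasure P]
    [IsProbabilityMeasure Q] : IsTradeoffShape (tradeoff P Q) where
  nonneg := tradeoff_nonneg P Q
  le_one_sub := tradeoff_le_one_sub P Q
  antitone := tradeoff_antitone P Q
  convex _ _ _ _ _ hs ht hst hγ := tradeoff_convex P Q hs ht hst hγ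
  right_cont_zero _ hε := tradeoff_right_cont_zero P Q hε

theorem TradeoffFun.shape (f : TradeoffFun) : IsTradeoffShape f.1 :=
  f.tradeoff_pair ▸ isTradeoffShape_tradeoff _ _

/-- Point-wise inequalities away from `0` extend to `0`. -/
theorem IsTradeoffShape.le_of_pos {f g : unitInterval → ℝ} (hf : IsTradeoffShape f)
    (hg : Antitone g) (h : ∀ α, 0 < α → f α ≤ g α) : f ≤ g := by
  intro α
  rcases eq_or_lt_of_le α.2.1 with h0 | h0
  · have h0' : α = 0 := Subtype.ext h0.symm
    subst h0'
    refine le_of_forall_pos_le_add fun ε hε => ?_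
    obtain ⟨β, hβ, h1⟩ := hf.right_cont_zero ε hε
    linarith [h β hβ, hg hβ.le]
  · exact h α (Subtype.coe_lt_coe.1 h0)

/-- A comparison of hockey-stick divergences gives a comparison of trade-off functions. -/
theorem tradeoff_le_of_hockey (P Q : Measure Ω) [IsProbabilityMeasure P] [IsProbabilityMeasure Q]
    (P' Q' : Measure Ω') [IsProbabilityMeasure P'] [IsProbabilityMeasure Q']
    (h : ∀ c : ℝ, 0 ≤ c → hockey P Q 1 c ≤ hockey P' Q' 1 c) :
    tradeoff P' Q' ≤ tradeoff P Q := by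
  have hs := isTradeoffShape_tradeoff P' Q'
  refine hs.le_of_pos (tradeoff_antitone P Q) fun α hα => le_tradeoff P Q fun φ hφ hφα => ?_
  -- The supporting line at `α` bounds the divergence with weight `c` by its intercept; this is
  -- convex conjugation evaluated at one slope.
  obtain ⟨c, hc, hsup⟩ := hs.exists_support hα
  have h1 : hockey P' Q' 1 c ≤ 1 - tradeoff P' Q' α - c * α := hockey_le fun ψ hψ => by
    have h2 := tradeoff_le P' Q' hψ
      (α := ⟨∫ y, ψ y ∂P', hψ.integral_nonneg P', hψ.integral_le_one P'⟩) le_rfl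
    have h3 := hsup ⟨∫ y, ψ y ∂P', hψ.integral_nonneg P', hψ.integral_le_one P'⟩
    simp only at h3
    linarith
  have h2 := le_hockey P Q zero_le_one hc hφ
  nlinarith [h c hc, mul_le_mul_of_nonneg_left hφα hc]

theorem hockey_mono (P Q : Measure Ω) [IsProbabilityMeasure P] [IsProbabilityMeasure Q]
    (P' Q' : Measure Ω') [IsProbabilityMeasure P'] [IsProbabilityMeasure Q']
    (h : tradeoff P' Q' ≤ tradeoff P Q) {a b : ℝ} (ha : 0 ≤ a) (hb : 0 ≤ b) :
    hockey P Q a b ≤ hockey P' Q' a b := by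
  have := hockey_le_of_tradeoff P Q P' Q' le_rfl (fun α β hαβ => by
    have : β = α := Subtype.ext (by simpa using hαβ)
    rw [this, sub_zero]; exact h α) ha hb
  simpa using this

theorem tradeoff_map_equiv (P Q : Measure Ω) [IsProbabilityMeasure P] [IsProbabilityMeasure Q]
    (e : Ω ≃ᵐ Ω') : tradeoff (P.map e) (Q.map e) = tradeoff P Q := by
  have : IsProbabilityMeasure (P.map e) := Measure.isProbabilityMeasure_map e.measurable.aemeasurable
  have : IsProbabilityMeasure (Q.map e) := Measure.isProbabilityMeasure_map e.measurable.aemeasurable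
  refine le_antisymm ?_ (tradeoff_map_ge P Q e.measurable)
  simpa using tradeoff_map_ge (P.map e) (Q.map e) e.symm.measurable

theorem tradeoff_prod_swap (P Q : Measure Ω) [IsProbabilityMeasure P] [IsProbabilityMeasure Q]
    (P' Q' : Measure Ω') [IsProbabilityMeasure P'] [IsProbabilityMeasure Q'] :
    tradeoff (P'.prod P) (Q'.prod Q) = tradeoff (P.prod P') (Q.prod Q') := by
  rw [← tradeoff_map_equiv _ _ (MeasurableEquiv.prodComm (α := Ω) (β := Ω'))]
  change _ = tradeoff (Measure.map Prod.swap _) (Measure.map Prod.swap _)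
  rw [Measure.prod_swap, Measure.prod_swap]

/-- With the densities of the common factor as weights, the two product divergences are integrals of
divergences that compare pointwise. -/
theorem tradeoff_prod_mono_right {Ω'' : Type*} [MeasurableSpace Ω'']
    (P Q : Measure Ω) [IsProbabilityMeasure P] [IsProbabilityMeasure Q]
    (P' Q' : Measure Ω') [IsProbabilityMeasure P'] [IsProbabilityMeasure Q']
    (P'' Q'' : Measure Ω'') [IsProbabilityMeasure P''] [IsProbabilityMeasure Q'']
    (h : tradeoff P' Q' ≤ tradeoff P'' Q'') :
    tradeoff (P.prod P') (Q.prod Q') ≤ tradeoff (P.prod P'') (Q.prod Q'') := by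
  refine tradeoff_le_of_hockey _ _ _ _ fun c hc => ?_
  obtain ⟨μ, _, p, q, hp, hq, hP, hQ⟩ := exists_densities P Q
  obtain ⟨h1, e1⟩ := hockey_prod P Q P' Q' hp hq hP hQ zero_le_one hc
  obtain ⟨h2, e2⟩ := hockey_prod P Q P'' Q'' hp hq hP hQ zero_le_one hc
  rw [e1, e2]
  exact integral_mono h2 h1 fun y => hockey_mono _ _ _ _ h (by positivity) (by positivity)

theorem tradeoff_prod_mono {Ω₁ Ω₂ : Type*} [MeasurableSpace Ω₁] [MeasurableSpace Ω₂]
    (P Q : Measure Ω) [IsProbabilityMeasure P] [IsProbabilityMeasure Q]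
    (P' Q' : Measure Ω') [IsProbabilityMeasure P'] [IsProbabilityMeasure Q']
    (P₁ Q₁ : Measure Ω₁) [IsProbabilityMeasure P₁] [IsProbabilityMeasure Q₁]
    (P₂ Q₂ : Measure Ω₂) [IsProbabilityMeasure P₂] [IsProbabilityMeasure Q₂]
    (h : tradeoff P Q ≤ tradeoff P₁ Q₁) (h' : tradeoff P' Q' ≤ tradeoff P₂ Q₂) :
    tradeoff (P.prod P') (Q.prod Q') ≤ tradeoff (P₁.prod P₂) (Q₁.prod Q₂) := by
  refine (tradeoff_prod_mono_right P Q P' Q' P₂ Q₂ h').trans ?_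
  rw [← tradeoff_prod_swap P, ← tradeoff_prod_swap P₁]
  exact tradeoff_prod_mono_right P₂ Q₂ P Q P₁ Q₁ h

end

/-! ### The tensor product -/

namespace TradeoffFun

/-- The trade-off function of a pair of distributions. -/
def ofPair (D : DistPair) : TradeoffFun := ⟨tradeoff D.P D.Q, D, rfl⟩

theorem ofPair_pair (f : TradeoffFun) : ofPair f.pair = f := Subtype.ext f.tradeoff_pair

/-- Independence of the representing pairs: monotonicity of products in both factors, applied in
both directions. -/
theorem ofPair_tensor (D E : DistPair) : (ofPair D).tensor (ofPair E) = ofPair (D.prod E) := by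
  refine le_antisymm ?_ ?_
  · exact tradeoff_prod_mono _ _ _ _ _ _ _ _ (ofPair D).tradeoff_pair.le (ofPair E).tradeoff_pair.le
  · exact tradeoff_prod_mono _ _ _ _ _ _ _ _ (ofPair D).tradeoff_pair.ge (ofPair E).tradeoff_pair.ge

theorem tensor_comm (f g : TradeoffFun) : f.tensor g = g.tensor f :=
  Subtype.ext (tradeoff_prod_swap _ _ _ _)

theorem tensor_assoc (f g h : TradeoffFun) : (f.tensor g).tensor h = f.tensor (g.tensor h) := by
  rw [← ofPair_pair f, ← ofPair_pair g, ← ofPair_pair h]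
  simp only [ofPair_tensor]
  refine Subtype.ext ?_
  change tradeoff ((f.pair.P.prod g.pair.P).prod h.pair.P) ((f.pair.Q.prod g.pair.Q).prod h.pair.Q)
    = tradeoff (f.pair.P.prod (g.pair.P.prod h.pair.P)) (f.pair.Q.prod (g.pair.Q.prod h.pair.Q))
  rw [← tradeoff_map_equiv _ _ (MeasurableEquiv.prodAssoc (α := f.pair.Ω) (β := g.pair.Ω)
    (γ := h.pair.Ω)), Measure.prodAssoc_prod, Measure.prodAssoc_prod]

theorem tensor_id (f : TradeoffFun) : f.tensor id = f := by
  have hid : id = ofPair ⟨Unit, Measure.dirac (), Measure.dirac ()⟩ :=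
    Subtype.ext (tradeoff_self _).symm
  conv_lhs => rw [← ofPair_pair f, hid, ofPair_tensor]
  refine Subtype.ext ?_
  conv_rhs => rw [← f.tradeoff_pair]
  change tradeoff (f.pair.P.prod (Measure.dirac ())) (f.pair.Q.prod (Measure.dirac ())) = _
  refine le_antisymm ?_ ?_
  · have := tradeoff_map_ge (f.pair.P.prod (Measure.dirac ())) (f.pair.Q.prod (Measure.dirac ()))
      measurable_fst
    simpa using this
  · rw [Measure.prod_dirac, Measure.prod_dirac]
    exact tradeoff_map_ge _ _ (by fun_prop)

theorem id_tensor (f : TradeoffFun) : id.tensor f = f := by rw [tensor_comm, tensor_id]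

theorem le_id (f : TradeoffFun) : f ≤ id := f.shape.le_one_sub

end TradeoffFun

/-! ### Adaptive composition -/

/-- Adaptive composition: if the first step is at least `f` private and the second one at least
`g` private whatever the output of the first, then the composition is at least `f ⊗ g` private. -/
theorem tensor_le_tradeoff_bind {Y Z : Type*} [MeasurableSpace Y] [MeasurableSpace Z]
    (P Q : Measure Y) [IsProbabilityMeasure P] [IsProbabilityMeasure Q]
    (κ η : Kernel Y Z) [IsMarkovKernel κ] [IsMarkovKernel η] {f g : TradeoffFun}
    (hf : f.1 ≤ tradeoff P Q) (hg : ∀ y, g.1 ≤ tradeoff (κ y) (η y)) :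
    (f.tensor g).1 ≤ tradeoff (P.bind κ) (Q.bind η) := by
  have e : ∀ (ν : Measure Y) [IsProbabilityMeasure ν] (θ : Kernel Y Z) [IsMarkovKernel θ]
      (φ : Z → ℝ), IsTest φ → IsTest (fun y => ∫ z, φ z ∂(θ y)) ∧
      ∫ z, φ z ∂(ν.bind θ) = ∫ y, ∫ z, φ z ∂(θ y) ∂ν := fun ν _ θ _ φ hφ => by
    refine ⟨⟨hφ.measurable.stronglyMeasurable.integral_kernel.measurable,
      fun y => hφ.integral_nonneg _, fun y => hφ.integral_le_one _⟩, ?_⟩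
    have := Kernel.integral_comp (η := θ) (κ := Kernel.const Unit ν) (a := ()) (f := φ)
      (by rw [Kernel.comp_apply]; exact hφ.integrable _)
    simpa [Kernel.comp_apply] using this
  refine le_trans ?_ (tradeoff_le_of_hockey _ _ (P.prod g.pair.P) (Q.prod g.pair.Q)
    fun c hc => hockey_le fun φ hφ => ?_)
  · exact tradeoff_prod_mono _ _ _ _ _ _ _ _ (by rwa [f.tradeoff_pair]) le_rfl
  · rw [(e P κ φ hφ).2, (e Q η φ hφ).2]
    -- A test on the final output induces on each fibre the values `E_{κ y}[φ]` and `E_{η y}[φ]`,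
    -- controlled by `g` alone. Hence no jointly measurable densities of `κ` and `η` are needed.
    have := le_hockey_prod P Q g.pair.P g.pair.Q (δ := 0) (e P κ φ hφ).1 (e Q η φ hφ).1
      (fun y a b ha hb => by
        rw [mul_zero, add_zero]
        exact (le_hockey (κ y) (η y) ha hb hφ).trans (hockey_mono _ _ _ _
          (by rw [g.tradeoff_pair]; exact hg y) ha hb)) zero_le_one hc
    simpa using this

/-! ### `Δ`-limits -/

theorem deltaDiv_nonneg (f g : TradeoffFun) : 0 ≤ deltaDiv f g :=
  Real.sInf_nonneg fun _ h => h.1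

theorem exists_delta_of_deltaDiv_lt {f g : TradeoffFun} {ε : ℝ} (h : deltaDiv f g < ε) :
    ∃ δ, 0 ≤ δ ∧ δ < ε ∧ ∀ α β : unitInterval, (β : ℝ) = α + δ →
      f.1 β - δ ≤ g.1 α ∧ g.1 β - δ ≤ f.1 α := by
  -- The value `1` is always admissible, because trade-off functions take values in `[0, 1]`.
  have hne : {δ : ℝ | 0 ≤ δ ∧ ∀ α β : unitInterval, (β : ℝ) = α + δ →
      f.1 β - δ ≤ g.1 α ∧ g.1 β - δ ≤ f.1 α}.Nonempty := ⟨1, zero_le_one, fun α β _ => by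
    constructor <;>
    linarith [f.shape.le_one_sub β, g.shape.le_one_sub β, β.2.1, f.shape.nonneg α,
      g.shape.nonneg α]⟩
  obtain ⟨δ, ⟨h0, h1⟩, h2⟩ := exists_lt_of_csInf_lt hne h
  exact ⟨δ, h0, h2, h1⟩

theorem deltaDiv_le {f g : TradeoffFun} {δ : ℝ} (h0 : 0 ≤ δ)
    (h : ∀ α β : unitInterval, (β : ℝ) = α + δ → f.1 β - δ ≤ g.1 α ∧ g.1 β - δ ≤ f.1 α) :
    deltaDiv f g ≤ δ :=
  csInf_le ⟨0, fun _ h => h.1⟩ ⟨h0, h⟩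

theorem deltaDiv_self (f : TradeoffFun) : deltaDiv f f = 0 :=
  le_antisymm (deltaDiv_le le_rfl fun α β h => by
    have : β = α := Subtype.ext (by simpa using h)
    simp [this]) (deltaDiv_nonneg f f)

/-- Lower bounds on tensor products pass to `Δ`-limits. -/
theorem le_tensor_of_tendsto {a g fB : TradeoffFun} {f : ℕ → TradeoffFun}
    (h : ∀ n, fB ≤ a.tensor (f n)) (hlim : Tendsto (fun n => deltaDiv (f n) g) atTop (𝓝 0)) :
    fB ≤ a.tensor g := by
  have key : tradeoff fB.pair.P fB.pair.Q ≤ tradeoff (a.pair.P.prod g.pair.P)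
      (a.pair.Q.prod g.pair.Q) := by
    refine tradeoff_le_of_hockey _ _ _ _ fun c hc => ?_
    refine le_of_forall_pos_le_add fun ε hε => ?_
    -- A shift by `δ` costs `(q + c p) δ` on each fibre, which integrates to `(1 + c) δ` because
    -- densities have mass one.
    obtain ⟨n, hn⟩ := (hlim.eventually (gt_mem_nhds (show 0 < ε / (1 + c) by positivity))).exists
    obtain ⟨δ, h0, h1, h2⟩ := exists_delta_of_deltaDiv_lt hn
    have h3 : (1 + c) * δ ≤ ε := by rw [lt_div_iff₀ (by positivity)] at h1; linarith
    have h4 : hockey (a.pair.P.prod g.pair.P) (a.pair.Q.prod g.pair.Q) 1 c ≤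
        hockey (a.pair.P.prod (f n).pair.P) (a.pair.Q.prod (f n).pair.Q) 1 c + (1 + c) * δ := by
      refine hockey_le fun φ hφ => ?_
      rw [integral_prod _ (hφ.integrable _), integral_prod _ (hφ.integrable _)]
      have hfib : ∀ y, IsTest fun z => φ (y, z) := fun y => hφ.comp measurable_prodMk_left
      refine le_hockey_prod a.pair.P a.pair.Q (f n).pair.P (f n).pair.Q
        ⟨hφ.measurable.stronglyMeasurable.integral_prod_right'.measurable,
          fun y => (hfib y).integral_nonneg _, fun y => (hfib y).integral_le_one _⟩
        ⟨hφ.measurable.stronglyMeasurable.integral_prod_right'.measurable,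
          fun y => (hfib y).integral_nonneg _, fun y => (hfib y).integral_le_one _⟩
        (fun y s t hs ht => ?_) zero_le_one hc
      refine (le_hockey g.pair.P g.pair.Q hs ht (hfib y)).trans
        (hockey_le_of_tradeoff _ _ _ _ h0 (fun α β hαβ => ?_) hs ht)
      rw [TradeoffFun.tradeoff_pair, TradeoffFun.tradeoff_pair]
      exact (h2 α β hαβ).1
    have h5 : hockey (a.pair.P.prod (f n).pair.P) (a.pair.Q.prod (f n).pair.Q) 1 c ≤
        hockey fB.pair.P fB.pair.Q 1 c :=
      hockey_mono _ _ _ _ (by rw [fB.tradeoff_pair]; exact h n) zero_le_one hc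
    linarith
  rw [fB.tradeoff_pair] at key
  exact key

/-! ### Every function of the right shape is a trade-off function -/

/-- Truncation to the unit interval. -/
def clamp (x : ℝ) : ℝ := max 0 (min 1 x)

theorem coe_projIcc (x : ℝ) : (Set.projIcc (0 : ℝ) 1 zero_le_one x : ℝ) = clamp x := rfl

theorem clamp_mono : Monotone clamp := fun _ _ h => max_le_max le_rfl (min_le_min le_rfl h)

theorem clamp_continuous : Continuous clamp := by unfold clamp; fun_prop

theorem clamp_coe (α : unitInterval) : clamp α = α := by
  rw [← coe_projIcc, Set.projIcc_val]

/-- The uniform distribution function. -/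
def uniformStieltjes : StieltjesFunction ℝ where
  toFun := clamp
  mono' := clamp_mono
  right_continuous' _ := clamp_continuous.continuousWithinAt

namespace IsTradeoffShape

variable {f : unitInterval → ℝ}

theorem right_cont (hf : IsTradeoffShape f) (α : unitInterval) {ε : ℝ} (hε : 0 < ε) :
    ∃ δ > 0, ∀ β : unitInterval, (β : ℝ) ≤ α + δ → f α ≤ f β + ε := by
  rcases eq_or_lt_of_le (unitInterval.nonneg' (t := α)) with rfl | h0
  · obtain ⟨δ, hδ, h⟩ := hf.right_cont_zero ε hε
    refine ⟨δ, hδ, fun β hβ => h.trans ?_⟩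
    have : β ≤ δ := Subtype.coe_le_coe.1 (by simpa using hβ)
    linarith [hf.antitone this]
  · obtain ⟨c, hc, h⟩ := hf.exists_support h0
    refine ⟨ε / (c + 1), by positivity, fun β hβ => ?_⟩
    have h1 : (c + 1) * (ε / (c + 1)) = ε := by field_simp
    have h2 : 0 < ε / (c + 1) := by positivity
    nlinarith [h β, mul_le_mul_of_nonneg_left hβ hc]

/-- The distribution function `1 - f` on the unit interval. -/
def cdfFun (f : unitInterval → ℝ) (x : ℝ) : ℝ :=
  if x < 0 then 0 else 1 - f (Set.projIcc 0 1 zero_le_one x)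

theorem cdfFun_coe (f : unitInterval → ℝ) (α : unitInterval) : cdfFun f α = 1 - f α := by
  rw [cdfFun, if_neg (not_lt.2 α.2.1), Set.projIcc_val]

theorem cdfFun_of_neg (f : unitInterval → ℝ) {x : ℝ} (h : x < 0) : cdfFun f x = 0 := if_pos h

theorem cdfFun_of_one_le (hf : IsTradeoffShape f) {x : ℝ} (h : 1 ≤ x) : cdfFun f x = 1 := by
  rw [cdfFun, if_neg (by linarith), Set.projIcc_of_right_le _ h]
  have h1 := hf.nonneg 1
  have h2 := hf.le_one_sub 1
  simp only [Set.Icc.coe_one, sub_self] at h2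
  change 1 - f 1 = 1
  linarith

theorem cdfFun_mono (hf : IsTradeoffShape f) : Monotone (cdfFun f) := by
  intro x y hxy
  unfold cdfFun
  split_ifs with h1 h2 h2
  · exact le_rfl
  · linarith [hf.le_one_sub (Set.projIcc 0 1 zero_le_one y), (Set.projIcc (0 : ℝ) 1 zero_le_one y).2.1]
  · linarith
  · linarith [hf.antitone (Set.monotone_projIcc (zero_le_one' ℝ) hxy)]

/-- The Stieltjes function `1 - f` on the unit interval. -/
def cdf (hf : IsTradeoffShape f) : StieltjesFunction ℝ where
  toFun := cdfFun f
  mono' := hf.cdfFun_mono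
  right_continuous' x := by
    rcases lt_or_ge x 0 with hx | hx
    · refine (continuousWithinAt_const (b := (0 : ℝ))).congr_of_eventuallyEq ?_ (cdfFun_of_neg f hx)
      filter_upwards [mem_nhdsWithin_of_mem_nhds (Iio_mem_nhds hx)] with y hy
      exact cdfFun_of_neg f hy
    · rw [Metric.continuousWithinAt_iff]
      intro ε hε
      obtain ⟨δ, hδ, h⟩ := hf.right_cont (Set.projIcc 0 1 zero_le_one x) (half_pos hε)
      refine ⟨δ, hδ, fun y hy hyx => ?_⟩
      have hy' : x ≤ y := hy
      rw [Real.dist_eq, abs_of_nonneg (by linarith)] at hyx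
      have h1 := h (Set.projIcc 0 1 zero_le_one y) (by
        rw [coe_projIcc, coe_projIcc]
        unfold clamp
        rw [min_def, min_def, max_def, max_def]
        split_ifs <;> linarith)
      rw [Real.dist_eq, abs_of_nonneg (sub_nonneg.2 (hf.cdfFun_mono hy')), cdfFun,
        if_neg (by linarith), cdfFun, if_neg (by linarith)]
      linarith

/-- To the left of `α`, convexity makes `f` at least as steep as the supporting line. This is the
monotonicity behind `excess`; `sub_le_of_ge` is the mirror image for `deficit`. -/
theorem sub_ge_of_le (hf : IsTradeoffShape f) {α : unitInterval} {c : ℝ}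
    (hc : ∀ β : unitInterval, f α + c * ((α : ℝ) - β) ≤ f β) {x y : unitInterval}
    (hxy : x ≤ y) (hy : y ≤ α) : c * ((y : ℝ) - x) ≤ f x - f y := by
  rcases eq_or_lt_of_le (hxy.trans hy) with rfl | hlt
  · rw [le_antisymm hy hxy]; simp
  · have h0 : (x : ℝ) < α := hlt
    have h1 : (x : ℝ) ≤ y := hxy
    have h2 : (y : ℝ) ≤ α := hy
    have h4 := hf.convex x α y ((α - y) / (α - x)) ((y - x) / (α - x))
        (div_nonneg (by linarith) (by linarith)) (div_nonneg (by linarith) (by linarith))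
        (by field_simp [show (α : ℝ) - x ≠ 0 by linarith]; ring)
        (by field_simp [show (α : ℝ) - x ≠ 0 by linarith]; ring)
    rw [div_mul_eq_mul_div, div_mul_eq_mul_div, ← add_div, le_div_iff₀ (by linarith)] at h4
    have h5 := mul_le_mul_of_nonneg_left (hc x) (sub_nonneg.2 h1)
    have h6 : 0 < (α : ℝ) - x := by linarith
    refine le_of_mul_le_mul_right ?_ h6
    linarith

theorem sub_le_of_ge (hf : IsTradeoffShape f) {α : unitInterval} {c : ℝ}
    (hc : ∀ β : unitInterval, f α + c * ((α : ℝ) - β) ≤ f β) {x y : unitInterval}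
    (hx : α ≤ x) (hxy : x ≤ y) : f x - f y ≤ c * ((y : ℝ) - x) := by
  rcases eq_or_lt_of_le (hx.trans hxy) with rfl | hlt
  · rw [le_antisymm hxy hx]; simp
  · have h0 : (α : ℝ) < y := hlt
    have h1 : (x : ℝ) ≤ y := hxy
    have h2 : (α : ℝ) ≤ x := hx
    have h4 := hf.convex α y x ((y - x) / (y - α)) ((x - α) / (y - α))
        (div_nonneg (by linarith) (by linarith)) (div_nonneg (by linarith) (by linarith))
        (by field_simp [show (y : ℝ) - α ≠ 0 by linarith]; ring)
        (by field_simp [show (y : ℝ) - α ≠ 0 by linarith]; ring)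
    rw [div_mul_eq_mul_div, div_mul_eq_mul_div, ← add_div, le_div_iff₀ (by linarith)] at h4
    have h5 := mul_le_mul_of_nonneg_left (hc y) (sub_nonneg.2 h1)
    have h6 : 0 < (y : ℝ) - α := by linarith
    refine le_of_mul_le_mul_right ?_ h6
    linarith

/-- The part of `Q - c P` to the left of the support point `α`. -/
def excess (hf : IsTradeoffShape f) {α : unitInterval} {c : ℝ}
    (hc : ∀ β : unitInterval, f α + c * ((α : ℝ) - β) ≤ f β) : StieltjesFunction ℝ where
  toFun x := cdfFun f (min x α) - c * clamp (min x α)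
  mono' x y hxy := by
    have key : ∀ z : ℝ, 0 ≤ z → cdfFun f (min z α) =
        1 - f (Set.projIcc 0 1 zero_le_one (min z α)) := fun z hz =>
      if_neg (not_lt.2 (le_min hz α.2.1))
    have hle : ∀ z : ℝ, Set.projIcc (0 : ℝ) 1 zero_le_one (min z α) ≤ α := fun z => by
      rw [← Subtype.coe_le_coe, coe_projIcc]
      exact (clamp_mono (min_le_right _ _)).trans (clamp_coe α).le
    have h0 : clamp 0 = 0 := by simp [clamp]
    simp only
    rcases lt_or_ge y 0 with hy | hy
    · have hx : x < 0 := by linarith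
      rw [cdfFun_of_neg f (min_lt_of_left_lt hx), cdfFun_of_neg f (min_lt_of_left_lt hy)]
      have : ∀ z : ℝ, z < 0 → clamp (min z α) = 0 := fun z hz => by
        rw [clamp, max_eq_left]; exact (min_le_right _ _).trans ((min_le_left _ _).trans hz.le)
      rw [this x hx, this y hy]
    · rw [key y hy, ← coe_projIcc (min y α)]
      rcases lt_or_ge x 0 with hx | hx
      · have e : clamp (min x α) = 0 := by
          rw [clamp, max_eq_left]; exact (min_le_right _ _).trans ((min_le_left _ _).trans hx.le)
        rw [cdfFun_of_neg f (min_lt_of_left_lt hx), e]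
        -- Crossing `0` picks up the atom of mass `1 - f 0`, nonnegative since `f 0 ≤ 1`.
        have := hf.sub_ge_of_le hc (unitInterval.nonneg'
          (t := Set.projIcc 0 1 zero_le_one (min y α))) (hle y)
        have h1 := hf.le_one_sub 0
        simp only [Set.Icc.coe_zero, sub_zero] at this h1
        linarith
      · rw [key x hx, ← coe_projIcc (min x α)]
        have := hf.sub_ge_of_le hc (Set.monotone_projIcc (zero_le_one' ℝ)
          (min_le_min_right (α : ℝ) hxy)) (hle y)
        linarith
  right_continuous' x := by
    refine ContinuousWithinAt.sub ?_ (by have := clamp_continuous; fun_prop)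
    exact ContinuousWithinAt.comp (g := cdfFun f) (f := fun y => min y (α : ℝ))
      (t := Set.Ici (min x α)) (hf.cdf.right_continuous _)
      (by fun_prop) fun y hy => show min x α ≤ min y α from min_le_min_right _ hy

/-- The part of `c P - Q` to the right of the support point `α`. -/
def deficit (hf : IsTradeoffShape f) {α : unitInterval} {c : ℝ}
    (hc : ∀ β : unitInterval, f α + c * ((α : ℝ) - β) ≤ f β) : StieltjesFunction ℝ where
  -- The additive constant makes the function vanish up to `α`.
  toFun x := (c * clamp (max x α) - cdfFun f (max x α)) + (cdfFun f α - c * clamp α)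
  mono' x y hxy := by
    have key : ∀ z : ℝ, cdfFun f (max z α) =
        1 - f (Set.projIcc 0 1 zero_le_one (max z α)) := fun z =>
      if_neg (not_lt.2 (le_max_of_le_right α.2.1))
    have hle : α ≤ Set.projIcc (0 : ℝ) 1 zero_le_one (max x α) := by
      rw [← Subtype.coe_le_coe, coe_projIcc]
      exact (clamp_coe α).ge.trans (clamp_mono (le_max_right _ _))
    simp only
    rw [key, key, ← coe_projIcc (max x α), ← coe_projIcc (max y α)]
    have := hf.sub_le_of_ge hc hle (Set.monotone_projIcc (zero_le_one' ℝ)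
          (max_le_max_right (α : ℝ) hxy))
    linarith
  right_continuous' x := by
    refine ContinuousWithinAt.add (ContinuousWithinAt.sub
      (by have := clamp_continuous; fun_prop) ?_) continuousWithinAt_const
    exact ContinuousWithinAt.comp (g := cdfFun f) (f := fun y => max y (α : ℝ))
      (t := Set.Ici (max x α)) (hf.cdf.right_continuous _)
      (by fun_prop) fun y hy => show max x α ≤ max y α from max_le_max_right _ hy

theorem cdf_tendsto_atBot (hf : IsTradeoffShape f) : Tendsto hf.cdf atBot (𝓝 0) :=
  tendsto_const_nhds.congr' (by
    filter_upwards [eventually_lt_atBot (0 : ℝ)] with x hx using (cdfFun_of_neg f hx).symm)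

theorem cdf_tendsto_atTop (hf : IsTradeoffShape f) : Tendsto hf.cdf atTop (𝓝 1) :=
  tendsto_const_nhds.congr' (by
    filter_upwards [eventually_ge_atTop (1 : ℝ)] with x hx using (hf.cdfFun_of_one_le hx).symm)

theorem uniform_tendsto_atBot : Tendsto uniformStieltjes atBot (𝓝 0) :=
  tendsto_const_nhds.congr' (by
    filter_upwards [eventually_lt_atBot (0 : ℝ)] with x hx
    exact (max_eq_left ((min_le_right _ _).trans hx.le)).symm)

theorem uniform_tendsto_atTop : Tendsto uniformStieltjes atTop (𝓝 1) :=
  tendsto_const_nhds.congr' (by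
    filter_upwards [eventually_ge_atTop (1 : ℝ)] with x hx
    change 1 = max 0 (min 1 x)
    simp [hx])

instance : IsProbabilityMeasure uniformStieltjes.measure :=
  uniformStieltjes.isProbabilityMeasure uniform_tendsto_atBot uniform_tendsto_atTop

theorem isProbabilityMeasure_cdf (hf : IsTradeoffShape f) :
    IsProbabilityMeasure hf.cdf.measure :=
  hf.cdf.isProbabilityMeasure hf.cdf_tendsto_atBot hf.cdf_tendsto_atTop

/-- The test rejecting on `(-∞, α]` has level `α` and error `f α`. It is optimal because `Q - c P`,
with `-c` a supporting slope at `α`, is nonnegative to the left of `α` and nonpositive to the right.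
-/
theorem tradeoff_cdf (hf : IsTradeoffShape f) :
    tradeoff uniformStieltjes.measure hf.cdf.measure = f := by
  have := hf.isProbabilityMeasure_cdf
  refine le_antisymm (fun α => ?_) (hf.le_of_pos (tradeoff_antitone _ _) fun α hα => ?_)
  · have ht : IsTest ((Set.Iic (α : ℝ)).indicator fun _ => (1 : ℝ)) :=
      ⟨measurable_const.indicator measurableSet_Iic,
        fun y => Set.indicator_nonneg (fun _ _ => zero_le_one) y,
        fun y => Set.indicator_le_self' (fun _ _ => zero_le_one) y⟩
    have e1 : uniformStieltjes α = α := clamp_coe α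
    have e2 : hf.cdf α = 1 - f α := cdfFun_coe f α
    have h1 : 0 ≤ 1 - f α := by linarith [hf.le_one_sub α, α.2.1]
    have := tradeoff_le uniformStieltjes.measure hf.cdf.measure ht (α := α) (by
      rw [integral_indicator_const _ measurableSet_Iic, measureReal_def,
        StieltjesFunction.measure_Iic _ uniform_tendsto_atBot, sub_zero, e1,
        ENNReal.toReal_ofReal α.2.1]
      simp)
    rw [integral_indicator_const _ measurableSet_Iic, measureReal_def,
      StieltjesFunction.measure_Iic _ hf.cdf_tendsto_atBot, sub_zero, e2,
      ENNReal.toReal_ofReal h1] at this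
    simpa using this
  · obtain ⟨c', hc0, hc⟩ := hf.exists_support hα
    obtain ⟨c, rfl⟩ : ∃ c : NNReal, (c : ℝ) = c' := ⟨⟨c', hc0⟩, rfl⟩
    refine le_tradeoff _ _ fun φ hφ hφα => ?_
    -- This is `Q + (c P - Q)⁺ = c P + (Q - c P)⁺`, written with distribution functions. So `E_Q[φ]
    -- - c E_P[φ]` is at most the total mass `1 - f α - c α` of the excess.
    have hsum : hf.cdf + hf.deficit hc =
        c • uniformStieltjes + hf.excess hc := by
      ext x
      change cdfFun f x + ((c * clamp (max x α) - cdfFun f (max x α)) +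
        (cdfFun f α - c * clamp α)) = c * clamp x + (cdfFun f (min x α) - c * clamp (min x α))
      rcases le_total x α with h | h
      · rw [max_eq_right h, min_eq_left h]; ring
      · rw [max_eq_left h, min_eq_right h]; ring
    have hmeas : (hf.cdf + hf.deficit hc).measure =
        (c • uniformStieltjes + hf.excess hc).measure := by rw [hsum]
    rw [StieltjesFunction.measure_add, StieltjesFunction.measure_add,
      StieltjesFunction.measure_smul] at hmeas
    have hbot : Tendsto (hf.excess hc) atBot (𝓝 0) :=
      tendsto_const_nhds.congr' (by
        filter_upwards [eventually_lt_atBot (0 : ℝ)] with x hx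
        change 0 = cdfFun f (min x α) - c * clamp (min x α)
        rw [cdfFun_of_neg f (min_lt_of_left_lt hx), clamp, max_eq_left
          ((min_le_right _ _).trans ((min_le_left _ _).trans hx.le))]
        ring)
    have htop : Tendsto (hf.excess hc) atTop (𝓝 (1 - f α - c * α)) :=
      tendsto_const_nhds.congr' (by
        filter_upwards [eventually_ge_atTop (α : ℝ)] with x hx
        change _ = cdfFun f (min x α) - c * clamp (min x α)
        rw [min_eq_right hx, cdfFun_coe, clamp_coe])
    have hfinU : IsFiniteMeasure (hf.excess hc).measure :=
      StieltjesFunction.isFiniteMeasure _ hbot htop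
    have hfinV : IsFiniteMeasure (hf.deficit hc).measure :=
      isFiniteMeasure_of_le _ (hmeas ▸ Measure.le_add_left le_rfl)
    have hint := congrArg (fun μ => ∫ y, φ y ∂μ) hmeas
    rw [integral_add_measure (hφ.integrable _) (hφ.integrable _),
      integral_add_measure (hφ.integrable _) (hφ.integrable _),
      integral_smul_nnreal_measure] at hint
    have hU : ∫ y, φ y ∂(hf.excess hc).measure ≤ 1 - f α - c * α := by
      have h0 : 0 ≤ 1 - f α - c * α := by
        have := hc 0
        have h1 := hf.le_one_sub 0
        simp only [Set.Icc.coe_zero, sub_zero] at this h1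
        linarith
      have h1 := integral_mono (hφ.integrable (hf.excess hc).measure)
        (integrable_const (1 : ℝ)) hφ.le_one
      rw [integral_const, measureReal_def, StieltjesFunction.measure_univ _ hbot htop, sub_zero,
        ENNReal.toReal_ofReal h0, smul_eq_mul, mul_one] at h1
      exact h1
    have hV := hφ.integral_nonneg (hf.deficit hc).measure
    have hP := mul_le_mul_of_nonneg_left hφα hc0
    change _ = (c : ℝ) * _ + _ at hint
    linarith

/-- The trade-off function with given values. -/
def toTradeoffFun (hf : IsTradeoffShape f) : TradeoffFun :=
  ⟨f, { Ω := ℝ, P := uniformStieltjes.measure, Q := hf.cdf.measure,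
        isProbQ := hf.isProbabilityMeasure_cdf }, hf.tradeoff_cdf⟩

end IsTradeoffShape

/-! ### Limits of decreasing sequences -/

section DecreasingLimit

/-- The point-wise infimum of a sequence of trade-off functions. -/
def seqInf (f : ℕ → TradeoffFun) (α : unitInterval) : ℝ := ⨅ n, (f n).1 α

/-- The right-continuous regularisation of the point-wise infimum. -/
def seqLimit (f : ℕ → TradeoffFun) (α : unitInterval) : ℝ := sSup (seqInf f '' Set.Ioi α)

variable (f : ℕ → TradeoffFun)

theorem bddBelow_seq (α : unitInterval) : BddBelow (Set.range fun n => (f n).1 α) :=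
  ⟨0, by rintro _ ⟨n, rfl⟩; exact (f n).shape.nonneg α⟩

theorem seqInf_le (n : ℕ) (α : unitInterval) : seqInf f α ≤ (f n).1 α :=
  ciInf_le (bddBelow_seq f α) n

theorem seqInf_nonneg (α : unitInterval) : 0 ≤ seqInf f α :=
  le_ciInf fun n => (f n).shape.nonneg α

theorem seqInf_antitone : Antitone (seqInf f) := fun _ _ h =>
  le_ciInf fun n => (seqInf_le f n _).trans ((f n).shape.antitone h)

theorem seqInf_le_seqLimit {α β : unitInterval} (h : α < β) : seqInf f β ≤ seqLimit f α := by
  refine le_csSup ⟨seqInf f α, ?_⟩ ⟨β, h, rfl⟩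
  rintro _ ⟨γ, hγ, rfl⟩
  exact seqInf_antitone f (le_of_lt hγ)

theorem seqLimit_nonneg (α : unitInterval) : 0 ≤ seqLimit f α :=
  Real.sSup_nonneg (by rintro _ ⟨γ, -, rfl⟩; exact seqInf_nonneg f γ)

/-- The condition `0 ≤ b` serves `α = 1`, where the supremum is over the empty set and equals `0`,
the correct value there. -/
theorem seqLimit_le {α : unitInterval} {b : ℝ} (hb : 0 ≤ b)
    (h : ∀ β, α < β → seqInf f β ≤ b) : seqLimit f α ≤ b :=
  Real.sSup_le (by rintro _ ⟨γ, hγ, rfl⟩; exact h γ hγ) hb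

theorem seqLimit_le_seqInf (α : unitInterval) : seqLimit f α ≤ seqInf f α :=
  seqLimit_le f (seqInf_nonneg f α) fun _ h => seqInf_antitone f h.le

variable {f}

theorem seqInf_convex (hf : Antitone f) {α β γ : unitInterval} {s t : ℝ} (hs : 0 ≤ s)
    (ht : 0 ≤ t) (hst : s + t = 1) (hγ : (γ : ℝ) = s * α + t * β) :
    seqInf f γ ≤ s * seqInf f α + t * seqInf f β := by
  have hlim : ∀ δ, Tendsto (fun n => (f n).1 δ) atTop (𝓝 (seqInf f δ)) := fun δ =>
    tendsto_atTop_ciInf (fun _ _ h => hf h δ) (bddBelow_seq f δ)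
  exact le_of_tendsto_of_tendsto' (hlim γ) (((hlim α).const_mul s).add ((hlim β).const_mul t))
    fun n => (f n).shape.convex α β γ s t hs ht hst hγ

theorem isTradeoffShape_seqLimit (hf : Antitone f) : IsTradeoffShape (seqLimit f) where
  nonneg := seqLimit_nonneg f
  le_one_sub α := (seqLimit_le_seqInf f α).trans ((seqInf_le f 0 α).trans ((f 0).shape.le_one_sub α))
  antitone _ _ h := seqLimit_le f (seqLimit_nonneg f _) fun _ h' => seqInf_le_seqLimit f (h.trans_lt h')
  convex α β γ s t hs ht hst hγ := by
    refine seqLimit_le f (add_nonneg (mul_nonneg hs (seqLimit_nonneg f _))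
      (mul_nonneg ht (seqLimit_nonneg f _))) fun ξ hξ => ?_
    have h1 : (γ : ℝ) < ξ := hξ
    have h2 : (0 : ℝ) < 1 - γ := by linarith [ξ.2.2]
    -- The contraction `δ ↦ δ + η (1 - δ)` towards `1` sends `γ` to `ξ` and preserves convex
    -- combinations. It moves every point except `1` strictly right, which is what comparing
    -- `seqInf` with `seqLimit` requires.
    set η : ℝ := (ξ - γ) / (1 - γ) with hη
    have hη0 : 0 < η := div_pos (by linarith) h2
    have hη1 : η ≤ 1 := (div_le_one h2).2 (by linarith [ξ.2.2])
    have hmul : η * (1 - γ) = ξ - γ := div_mul_cancel₀ _ h2.ne'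
    have key : ∀ δ : unitInterval, ∃ δ' : unitInterval, (δ' : ℝ) = δ + η * (1 - δ) ∧
        seqInf f δ' ≤ seqLimit f δ := fun δ => by
      refine ⟨⟨δ + η * (1 - δ), ?_, ?_⟩, rfl, ?_⟩
      · have := δ.2.1
        have := mul_nonneg hη0.le (sub_nonneg.2 δ.2.2)
        linarith
      · nlinarith [δ.2.2]
      · rcases eq_or_lt_of_le δ.2.2 with h | h
        · refine le_trans (seqInf_le f 0 _) (le_trans ((f 0).shape.le_one_sub _) (le_trans ?_
            (seqLimit_nonneg f δ)))
          simp [h]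
        · refine seqInf_le_seqLimit f (Subtype.coe_lt_coe.1 ?_)
          have := mul_pos hη0 (sub_pos.2 h)
          simp only
          linarith
    obtain ⟨α', hα', ha⟩ := key α
    obtain ⟨β', hβ', hb⟩ := key β
    refine (seqInf_convex hf hs ht hst (α := α') (β := β') ?_).trans (by gcongr)
    rw [hα', hβ']
    have : (ξ : ℝ) = γ + η * (1 - γ) := by linarith
    rw [this, hγ]
    linear_combination (-η) * hst
  right_cont_zero ε hε := by
    have hne : (seqInf f '' Set.Ioi 0).Nonempty := 
      ⟨_, 1, Set.mem_Ioi.2 zero_lt_one, rfl⟩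
    obtain ⟨_, ⟨β, hβ, rfl⟩, h⟩ := exists_lt_of_lt_csSup hne
      (show seqLimit f 0 - ε < sSup _ from sub_lt_self _ hε)
    obtain ⟨α, h0, h1⟩ := exists_between (Set.mem_Ioi.1 hβ)
    exact ⟨α, h0, by linarith [seqInf_le_seqLimit f h1]⟩

/-- A decreasing sequence of trade-off functions has a limit in `Δ`-divergence, which is a lower
bound of the sequence. -/
theorem exists_limit_of_antitone (hf : Antitone f) :
    ∃ g : TradeoffFun, Tendsto (fun n => deltaDiv (f n) g) atTop (𝓝 0) ∧ ∀ n, g ≤ f n := by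
  have hle : ∀ n α, seqLimit f α ≤ (f n).1 α := fun n α =>
    (seqLimit_le_seqInf f α).trans (seqInf_le f n α)
  refine ⟨(isTradeoffShape_seqLimit hf).toTradeoffFun, ?_, hle⟩
  refine tendsto_order.2 ⟨fun a ha => Eventually.of_forall fun n => ha.trans_le (deltaDiv_nonneg _ _),
    fun ε hε => ?_⟩
  obtain ⟨N, hN⟩ := exists_nat_one_div_lt (half_pos hε)
  have hN0 : (0 : ℝ) < N + 1 := by positivity
  -- Convergence on a finite grid of mesh below `ε / 2` suffices: some grid point lies in `(α, α + ε
  -- / 2]`, and monotonicity does the rest. The horizontal shift in the divergence absorbs jumps of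
  -- the limit. The index can reach `N + 1`, hence `N + 2` points.
  have hev : ∀ᶠ n in atTop, ∀ i ∈ Finset.range (N + 2),
      (f n).1 (Set.projIcc 0 1 zero_le_one ((i : ℝ) / (N + 1))) <
        seqInf f (Set.projIcc 0 1 zero_le_one ((i : ℝ) / (N + 1))) + ε / 2 :=
    (Filter.eventually_all_finset _).2 fun i _ =>
      (tendsto_atTop_ciInf (fun _ _ h => hf h _) (bddBelow_seq f _)).eventually
        (gt_mem_nhds (lt_add_of_pos_right _ (half_pos hε)))
  filter_upwards [hev] with n hn
  refine (deltaDiv_le (half_pos hε).le fun α β hαβ => ⟨?_, ?_⟩).trans_lt (half_lt_self hε)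
  · set i : ℕ := ⌊(α : ℝ) * (N + 1)⌋₊ + 1 with hi
    have hα0 : 0 ≤ (α : ℝ) * (N + 1) := mul_nonneg α.2.1 hN0.le
    have h1 : (α : ℝ) < i / (N + 1) := by
      rw [lt_div_iff₀ hN0, hi]; push_cast; exact Nat.lt_floor_add_one _
    have h2 : (i : ℝ) / (N + 1) ≤ β := by
      have : (i : ℝ) / (N + 1) ≤ α + 1 / (N + 1) := by
        rw [div_le_iff₀ hN0, add_mul, div_mul_cancel₀ _ hN0.ne', hi]
        push_cast
        linarith [Nat.floor_le hα0]
      linarith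
    have hmem : (i : ℝ) / (N + 1) ∈ Set.Icc (0 : ℝ) 1 := ⟨by positivity, h2.trans β.2.2⟩
    have hir : i ∈ Finset.range (N + 2) := by
      have h3 : (i : ℝ) ≤ N + 1 := (div_le_one hN0).1 hmem.2
      have h4 : i ≤ N + 1 := by exact_mod_cast h3
      exact Finset.mem_range.2 (by omega)
    have h5 := hn i hir
    rw [Set.projIcc_of_mem zero_le_one hmem] at h5
    have h6 : (f n).1 β ≤ (f n).1 ⟨_, hmem⟩ := (f n).shape.antitone (Subtype.coe_le_coe.1 h2)
    have h7 : seqInf f ⟨_, hmem⟩ ≤ seqLimit f α := seqInf_le_seqLimit f (Subtype.coe_lt_coe.1 h1)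
    change _ ≤ seqLimit f α
    linarith
  · have h1 : α ≤ β := Subtype.coe_le_coe.1 (by linarith)
    have h2 := (isTradeoffShape_seqLimit hf).antitone h1
    change seqLimit f β - ε / 2 ≤ _
    linarith [hle n α]

end DecreasingLimit

/-! ### Infima of Blackwell chains -/

/-- A strictly monotone functional on trade-off functions. -/
def weight (f : TradeoffFun) : ℝ := ∑' n : ℕ, (1 / 2 : ℝ) ^ n * f.1 (TopologicalSpace.denseSeq unitInterval n)

theorem summable_weight (f : TradeoffFun) :
    Summable fun n : ℕ => (1 / 2 : ℝ) ^ n * f.1 (TopologicalSpace.denseSeq unitInterval n) := by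
  refine Summable.of_nonneg_of_le (fun n => mul_nonneg (by positivity) (f.shape.nonneg _))
    (fun n => mul_le_of_le_one_right (by positivity) ?_) summable_geometric_two
  have := f.shape.le_one_sub (TopologicalSpace.denseSeq unitInterval n)
  linarith [(TopologicalSpace.denseSeq unitInterval n).2.1]

theorem weight_nonneg (f : TradeoffFun) : 0 ≤ weight f :=
  tsum_nonneg fun _ => mul_nonneg (by positivity) (f.shape.nonneg _)

/-- A strict gap at `α` persists on an interval to the right of `α`, since `g` is right-continuous
and `f` decreasing; a point of the dense sequence falls there. -/
theorem weight_strictMono : StrictMono weight := by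
  intro f g hfg
  obtain ⟨hle, α, hα⟩ := Pi.lt_def.1 (show f.1 < g.1 from hfg)
  have hα1 : (α : ℝ) < 1 := by
    have := g.shape.le_one_sub α
    have := f.shape.nonneg α
    linarith
  obtain ⟨δ, hδ, h⟩ := g.shape.right_cont α (half_pos (sub_pos.2 hα))
  have hopen : IsOpen {β : unitInterval | (α : ℝ) < β ∧ (β : ℝ) < α + δ} :=
    (isOpen_lt continuous_const continuous_subtype_val).inter
      (isOpen_lt continuous_subtype_val continuous_const)
  obtain ⟨x, hx1, hx2⟩ := exists_between (show (α : ℝ) < min 1 (α + δ) from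
    lt_min hα1 (by linarith))
  obtain ⟨n, h1, h2⟩ := (TopologicalSpace.denseRange_denseSeq unitInterval).exists_mem_open hopen
    ⟨⟨x, α.2.1.trans hx1.le, (hx2.trans_le (min_le_left _ _)).le⟩, hx1,
      hx2.trans_le (min_le_right _ _)⟩
  refine Summable.tsum_lt_tsum (i := n) (fun m => ?_) ?_ (summable_weight f) (summable_weight g)
  · exact mul_le_mul_of_nonneg_left (hle _) (by positivity)
  · refine mul_lt_mul_of_pos_left ?_ (by positivity)
    have h3 := h _ h2.le
    have h4 := f.shape.antitone (Subtype.coe_le_coe.1 h1.le)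
    linarith

/-- A nonempty Blackwell chain contains a decreasing sequence with a limit in `Δ`-divergence that
is a lower bound of the whole chain. -/
theorem IsBlackwellChain.exists_decreasing_limit {C : Set TradeoffFun} (hC : IsBlackwellChain C)
    (hne : C.Nonempty) :
    ∃ f : ℕ → TradeoffFun, (∀ n, f n ∈ C) ∧ Antitone f ∧ ∃ g : TradeoffFun,
      Tendsto (fun n => deltaDiv (f n) g) atTop (𝓝 0) ∧ ∀ r ∈ C, g ≤ r := by
  -- On a chain the weight also reflects the order, so minimising over `C` reduces to minimising a
  -- real number, and a sequence suffices.
  have hle : ∀ f ∈ C, ∀ g ∈ C, weight f ≤ weight g → f ≤ g := fun f hf g hg h =>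
    (hC f hf g hg).elim id fun h' =>
      (h'.eq_or_lt.elim Eq.ge fun h'' => absurd (weight_strictMono h'') (not_lt.2 h))
  have hglb : IsGLB (weight '' C) (sInf (weight '' C)) :=
    isGLB_csInf (hne.image _) ⟨0, by rintro _ ⟨f, -, rfl⟩; exact weight_nonneg f⟩
  by_cases hmem : sInf (weight '' C) ∈ weight '' C
  · obtain ⟨f, hf, hfw⟩ := hmem
    refine ⟨fun _ => f, fun _ => hf, antitone_const, f, by simp [deltaDiv_self], fun r hr => ?_⟩
    exact hle f hf r hr (hfw ▸ hglb.1 ⟨r, hr, rfl⟩)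
  · obtain ⟨w, hw, -, hlim, hwC⟩ := hglb.exists_seq_antitone_tendsto (hne.image _)
    choose f hf hfw using hwC
    have hanti : Antitone f := fun m n hmn =>
      hle _ (hf n) _ (hf m) (by rw [hfw, hfw]; exact hw hmn)
    obtain ⟨g, hg, hgle⟩ := exists_limit_of_antitone hanti
    refine ⟨f, hf, hanti, g, hg, fun r hr => ?_⟩
    have hlt : sInf (weight '' C) < weight r :=
      lt_of_le_of_ne (hglb.1 ⟨r, hr, rfl⟩) fun h => hmem (h ▸ ⟨r, hr, rfl⟩)
    obtain ⟨n, hn⟩ := (hlim.eventually (gt_mem_nhds hlt)).exists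
    exact (hgle n).trans (hle _ (hf n) r hr (by rw [hfw]; exact hn.le))

/-! ### The iterated limit-tensor families -/

theorem mem_decreasingLimits_of_mem {F : Set TradeoffFun} {f : TradeoffFun} (hf : f ∈ F) :
    f ∈ decreasingLimits F :=
  ⟨fun _ => f, fun _ => hf, antitone_const, by simp [deltaDiv_self]⟩

theorem decreasingLimits_mono {F G : Set TradeoffFun} (h : F ⊆ G) :
    decreasingLimits F ⊆ decreasingLimits G := fun _ ⟨f, hf, h1, h2⟩ =>
  ⟨f, fun n => h (hf n), h1, h2⟩

/-- Base case: `f = f ⊗ Id`, with `Id` the limit of a constant sequence. Nesting makes all earlier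
families chains once the last one is. -/
theorem limTensorIter_subset_succ {F : Set TradeoffFun} (hId : TradeoffFun.id ∈ F) (k : ℕ) :
    limTensorIter F k ⊆ limTensorIter F (k + 1) := by
  induction k with
  | zero => exact fun f hf => ⟨f, hf, TradeoffFun.id, mem_decreasingLimits_of_mem hId,
      (TradeoffFun.tensor_id f).symm⟩
  | succ k ih => exact fun _ ⟨f, hf, g, hg, e⟩ => ⟨f, hf, g, decreasingLimits_mono ih hg, e⟩

theorem limTensorIter_mono {F : Set TradeoffFun} (hId : TradeoffFun.id ∈ F) :
    Monotone (limTensorIter F) :=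
  monotone_nat_of_le_succ (limTensorIter_subset_succ hId)

/-! ### Histories and the levels along them -/

section Histories

variable {O : ℕ → Type v}

/-- Extension of a history by one more output. -/
def extend {t : ℕ} (h : Hist O t) (y : O t) : Hist O (t + 1) :=
  Fin.snoc (α := fun i : Fin (t + 1) => O i) h y

/-- The tensor product of the levels of the steps already run. -/
def prefixProd (f : (t : ℕ) → Hist O t → TradeoffFun) : (t : ℕ) → Hist O t → TradeoffFun
  | 0, _ => TradeoffFun.id
  | t + 1, h => tensorProd t (realisedLevels f (Fin.init h : Hist O t))

variable {f : (t : ℕ) → Hist O t → TradeoffFun}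

theorem tensorProd_realisedLevels {t : ℕ} (h : Hist O t) :
    tensorProd t (realisedLevels f h) = (prefixProd f t h).tensor (f t h) := by
  cases t with
  | zero => exact (TradeoffFun.id_tensor _).symm
  | succ t => rfl

theorem prefixProd_extend {t : ℕ} (h : Hist O t) (y : O t) :
    prefixProd f (t + 1) (extend h y) = (prefixProd f t h).tensor (f t h) := by
  rw [← tensorProd_realisedLevels, prefixProd, extend, Fin.init_snoc]

end Histories

/-! ### The law of the filtered composition -/

section Composition

variable {X : Type u} {O : ℕ → Type v} [∀ t, MeasurableSpace (O t)]

theorem measurable_extend (t : ℕ) :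
    Measurable fun z : Hist O t × O t => extend z.1 z.2 := by
  refine measurable_pi_lambda _ fun i => ?_
  induction i using Fin.lastCases with
  | last => simpa [extend] using measurable_snd
  | cast i => 
    simp only [extend, Fin.snoc_castSucc]
    exact (measurable_pi_apply i).comp measurable_fst

theorem measurable_transcript (t : ℕ) :
    Measurable fun h : Hist O t => (⟨t, h⟩ : Transcript O) :=
  fun _ hs => MeasurableSpace.measurableSet_iInf.1 hs t

variable (M : AdaptiveMechanisms X O) (f : (t : ℕ) → Hist O t → TradeoffFun)
  (filt : (t : ℕ) → (Fin (t + 1) → TradeoffFun) → Prop)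

theorem runFrom_of_cont (S : List X) (n : ℕ) {t : ℕ} {h : Hist O t}
    (hc : filt t (realisedLevels f h)) :
    runFrom M f filt S (n + 1) t h =
      (M.kernel t S h).bind fun y => runFrom M f filt S n (t + 1) (extend h y) := by
  rw [runFrom, if_pos hc]; rfl

theorem runFrom_of_halt (S : List X) (n : ℕ) {t : ℕ} {h : Hist O t}
    (hc : ¬ filt t (realisedLevels f h)) :
    runFrom M f filt S (n + 1) t h = Measure.dirac ⟨t, h⟩ := by
  rw [runFrom, if_neg hc]

variable {f filt}

/-- Measurability is carried in the whole history, so that the rest of the run, with the next output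
appended, is again a kernel. -/
theorem runFrom_measurable_isProbabilityMeasure {T : ℕ} (hmeas : MeasurableDecisions f filt T)
    (S : List X) (n : ℕ) : ∀ t, t + n ≤ T → Measurable (runFrom M f filt S n t) ∧
      ∀ h, IsProbabilityMeasure (runFrom M f filt S n t h) := by
  induction n with
  | zero =>
    intro t _
    exact ⟨Measure.measurable_dirac.comp (measurable_transcript t),
      fun h => Measure.dirac.isProbabilityMeasure⟩
  | succ n ih =>
    intro t ht
    obtain ⟨h1, h2⟩ := ih (t + 1) (by omega)
    constructor
    · classical
      have hb : Measurable fun h : Hist O t => (M.kernel t S h).bind fun y =>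
          runFrom M f filt S n (t + 1) (extend h y) := by
        refine Measure.measurable_of_measurable_coe _ fun s hs => ?_
        have hj : Measurable fun z : Hist O t × O t =>
            runFrom M f filt S n (t + 1) (extend z.1 z.2) s :=
          (Measure.measurable_coe hs).comp (h1.comp (measurable_extend t))
        have e : ∀ h : Hist O t, ((M.kernel t S h).bind fun y =>
            runFrom M f filt S n (t + 1) (extend h y)) s =
            ∫⁻ y, runFrom M f filt S n (t + 1) (extend h y) s ∂(M.kernel t S h) := fun h =>
          Measure.bind_apply hs
            ((h1.comp (measurable_extend t)).comp measurable_prodMk_left).aemeasurable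
        simp only [e]
        exact Measurable.lintegral_kernel_prod_right' hj
      have e : runFrom M f filt S (n + 1) t = fun h => if filt t (realisedLevels f h) then
          ((M.kernel t S h).bind fun y => runFrom M f filt S n (t + 1) (extend h y))
          else Measure.dirac ⟨t, h⟩ := by
        funext h
        split_ifs with hc
        · exact runFrom_of_cont M f filt S n hc
        · exact runFrom_of_halt M f filt S n hc
      rw [e]
      exact Measurable.ite (hmeas t (by omega)) hb
        (Measure.measurable_dirac.comp (measurable_transcript t))
    · intro h
      by_cases hc : filt t (realisedLevels f h)
      · rw [runFrom_of_cont M f filt S n hc]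
        have hm : Measurable fun y => runFrom M f filt S n (t + 1) (extend h y) :=
          (h1.comp (measurable_extend t)).comp measurable_prodMk_left
        exact isProbabilityMeasure_bind hm.aemeasurable (Eventually.of_forall fun y => h2 _)
      · rw [runFrom_of_halt M f filt S n hc]
        infer_instance

/-- The law of the rest of the procedure as a Markov kernel in the upcoming output. -/
def restKernel {T : ℕ} (hmeas : MeasurableDecisions f filt T) (S : List X) {n t : ℕ}
    (ht : t + 1 + n ≤ T) (h : Hist O t) : Kernel (O t) (Transcript O) :=
  ⟨fun y => runFrom M f filt S n (t + 1) (extend h y),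
    ((runFrom_measurable_isProbabilityMeasure M hmeas S n (t + 1) ht).1.comp
      (measurable_extend t)).comp measurable_prodMk_left⟩

instance {T : ℕ} (hmeas : MeasurableDecisions f filt T) (S : List X) {n t : ℕ}
    (ht : t + 1 + n ≤ T) (h : Hist O t) : IsMarkovKernel (restKernel M hmeas S ht h) :=
  ⟨fun _ => (runFrom_measurable_isProbabilityMeasure M hmeas S n (t + 1) ht).2 _⟩

/-- If the next step is `f t h` private and the rest of the procedure is at least `g` private
whatever the next output, then the procedure is at least `f t h ⊗ g` private. -/
theorem tensor_le_tradeoff_runFrom {T : ℕ} (hmeas : MeasurableDecisions f filt T)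
    {S S' : List X} {n t : ℕ} (ht : t + 1 + n ≤ T) {h : Hist O t}
    (hc : filt t (realisedLevels f h))
    (hdp : (f t h).1 ≤ tradeoff (M.kernel t S h) (M.kernel t S' h)) {g : TradeoffFun}
    (hg : ∀ y, g.1 ≤ tradeoff (runFrom M f filt S n (t + 1) (extend h y))
      (runFrom M f filt S' n (t + 1) (extend h y))) :
    ((f t h).tensor g).1 ≤
      tradeoff (runFrom M f filt S (n + 1) t h) (runFrom M f filt S' (n + 1) t h) := by
  rw [runFrom_of_cont M f filt S n hc, runFrom_of_cont M f filt S' n hc]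
  exact tensor_le_tradeoff_bind _ _ (restKernel M hmeas S ht h) (restKernel M hmeas S' ht h) hdp hg

/-! ### The natural filter -/

/-- One backward step: guarantees for the rest of the procedure that stay within the budget and
belong to a chain `G` are bounded below by a common one that still stays within the budget. -/
theorem exists_limit_guarantee {T : ℕ} {fB : TradeoffFun}
    (hmeas : MeasurableDecisions f (naturalFilter fB) T) {S S' : List X} {n t : ℕ}
    (ht : t + 1 + n ≤ T) {h : Hist O t} (hc : naturalFilter fB t (realisedLevels f h))
    (hdp : (f t h).1 ≤ tradeoff (M.kernel t S h) (M.kernel t S' h))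
    {G : Set TradeoffFun} (hG : IsBlackwellChain G) (hId : TradeoffFun.id ∈ G)
    (hrest : ∀ y, ∃ r ∈ G, r.1 ≤ tradeoff (runFrom M f (naturalFilter fB) S n (t + 1) (extend h y))
      (runFrom M f (naturalFilter fB) S' n (t + 1) (extend h y)) ∧
      fB ≤ (prefixProd f (t + 1) (extend h y)).tensor r) :
    ∃ g ∈ decreasingLimits G, ((f t h).tensor g).1 ≤
      tradeoff (runFrom M f (naturalFilter fB) S (n + 1) t h)
        (runFrom M f (naturalFilter fB) S' (n + 1) t h) ∧
      fB ≤ (prefixProd f t h).tensor ((f t h).tensor g) := by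
  set C : Set TradeoffFun := {r ∈ G | fB ≤ ((prefixProd f t h).tensor (f t h)).tensor r} with hC
  have hcB : fB ≤ (prefixProd f t h).tensor (f t h) := by
    rw [← tensorProd_realisedLevels]; exact hc
  obtain ⟨r, hr, hanti, g, hlim, hg⟩ := IsBlackwellChain.exists_decreasing_limit
    -- `C` is nonempty: it contains `Id` precisely because the filter accepted the current step.
    (C := C) (fun a ha b hb => hG a ha.1 b hb.1)
    ⟨TradeoffFun.id, hId, by rwa [TradeoffFun.tensor_id]⟩
  refine ⟨g, ⟨r, fun n => (hr n).1, hanti, hlim⟩,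
    tensor_le_tradeoff_runFrom M hmeas ht hc hdp fun y => ?_, ?_⟩
  · obtain ⟨s, hsG, hs, hsB⟩ := hrest y
    exact le_trans (b := s.1) (hg s ⟨hsG, by rwa [prefixProd_extend] at hsB⟩) hs
  · rw [← TradeoffFun.tensor_assoc]
    exact le_tensor_of_tendsto (fun n => (hr n).2) hlim

/-- The backward induction. Chains are needed only for `j < k`, because common lower bounds are
taken over guarantees of the remaining steps, not over the one being built. On halting the guarantee
is `Id`, and the budget bound is inherited from the prefix. -/
theorem exists_guarantee_runFrom {T : ℕ} {F : Set TradeoffFun} (hId : TradeoffFun.id ∈ F)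
    (hfF : ∀ t < T, ∀ h : Hist O t, f t h ∈ F) {fB : TradeoffFun}
    (hmeas : MeasurableDecisions f (naturalFilter fB) T) {S S' : List X}
    (hdp : ∀ t < T, ∀ h : Hist O t, (f t h).1 ≤ tradeoff (M.kernel t S h) (M.kernel t S' h))
    (k : ℕ) (hchain : ∀ j < k, IsBlackwellChain (limTensorIter F j)) :
    ∀ t, t + 1 + k ≤ T → ∀ h : Hist O t, fB ≤ prefixProd f t h →
      ∃ r ∈ limTensorIter F k, r.1 ≤ tradeoff (runFrom M f (naturalFilter fB) S (k + 1) t h)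
        (runFrom M f (naturalFilter fB) S' (k + 1) t h) ∧ fB ≤ (prefixProd f t h).tensor r := by
  have hIdk : ∀ k, TradeoffFun.id ∈ limTensorIter F k := fun k =>
    limTensorIter_mono hId (Nat.zero_le k) hId
  induction k with
  | zero =>
    intro t ht h hB
    by_cases hc : naturalFilter fB t (realisedLevels f h)
    · refine ⟨f t h, hfF t (by omega) h, ?_, by rw [← tensorProd_realisedLevels]; exact hc⟩
      have := tensor_le_tradeoff_runFrom M hmeas ht hc (hdp t (by omega) h) (g := TradeoffFun.id)
        fun y => by
          rw [runFrom, runFrom, tradeoff_self]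
      rwa [TradeoffFun.tensor_id] at this
    · refine ⟨TradeoffFun.id, hId, ?_, by rwa [TradeoffFun.tensor_id]⟩
      rw [runFrom_of_halt M f _ S 0 hc, runFrom_of_halt M f _ S' 0 hc, tradeoff_self]
  | succ k ih =>
    intro t ht h hB
    by_cases hc : naturalFilter fB t (realisedLevels f h)
    · obtain ⟨g, hg, h1, h2⟩ := exists_limit_guarantee M hmeas ht hc (hdp t (by omega) h)
        (hchain k k.lt_succ_self) (hIdk k) fun y =>
          ih (fun j hj => hchain j (hj.trans k.lt_succ_self)) (t + 1) (by omega) (extend h y) (by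
            rw [prefixProd_extend, ← tensorProd_realisedLevels]; exact hc)
      exact ⟨_, ⟨f t h, hfF t (by omega) h, g, hg, rfl⟩, h1, h2⟩
    · refine ⟨TradeoffFun.id, hIdk _, ?_, by rwa [TradeoffFun.tensor_id]⟩
      rw [runFrom_of_halt M f _ S _ hc, runFrom_of_halt M f _ S' _ hc, tradeoff_self]

/-- The natural filter keeps the composition within the budget, in one direction. -/
theorem le_tradeoff_filteredComposition {T : ℕ} (hT : 2 ≤ T) {F : Set TradeoffFun}
    (hId : TradeoffFun.id ∈ F) (hchain : IsBlackwellChain (limTensorIter F (T - 2)))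
    (hfF : ∀ t < T, ∀ h : Hist O t, f t h ∈ F) {fB : TradeoffFun}
    (hmeas : MeasurableDecisions f (naturalFilter fB) T) {S S' : List X}
    (hdp : ∀ t < T, ∀ h : Hist O t, (f t h).1 ≤ tradeoff (M.kernel t S h) (M.kernel t S' h)) :
    fB.1 ≤ tradeoff (filteredComposition M f (naturalFilter fB) T S)
      (filteredComposition M f (naturalFilter fB) T S') := by
  obtain ⟨m, rfl⟩ := Nat.exists_eq_add_of_le' hT
  have hle : ∀ j ≤ m, IsBlackwellChain (limTensorIter F j) := fun j hj a ha b hb =>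
    hchain a (limTensorIter_mono hId hj ha) b (limTensorIter_mono hId hj hb)
  unfold filteredComposition
  set h : Hist O 0 := fun i => i.elim0
  by_cases hc : naturalFilter fB 0 (realisedLevels f h)
  -- After the first of `m + 2` steps, `m + 1` remain, with guarantees in the `m`-th family. This is
  -- the last family over which a lower bound is taken, whence the exponent `T - 2`.
  · obtain ⟨g, -, h1, h2⟩ := exists_limit_guarantee M hmeas (n := m + 1) (by omega) hc
      (hdp 0 (by omega) h) (hle m le_rfl) (limTensorIter_mono hId (Nat.zero_le m) hId) fun y =>
        exists_guarantee_runFrom M hId hfF hmeas hdp m (fun j hj => hle j hj.le) 1 (by omega)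
          (extend h y) (by rw [prefixProd_extend, ← tensorProd_realisedLevels]; exact hc)
    rw [prefixProd, TradeoffFun.id_tensor] at h2
    exact le_trans h2 h1
  · rw [runFrom_of_halt M f _ S _ hc, runFrom_of_halt M f _ S' _ hc, tradeoff_self]
    exact fB.le_id

end Composition

end

end FDP

theorem theorem3p4 {X : Type u} {O : ℕ → Type v} [∀ t, MeasurableSpace (O t)]
    (T : ℕ) (hT : 2 ≤ T)
    (F : Set FDP.TradeoffFun) (hId : FDP.TradeoffFun.id ∈ F)
    (hchain : FDP.IsBlackwellChain (FDP.limTensorIter F (T - 2)))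
    (M : FDP.AdaptiveMechanisms X O) (f : (t : ℕ) → FDP.Hist O t → FDP.TradeoffFun)
    (hf : ∀ t < T, ∀ h : FDP.Hist O t, FDP.IsTightGuarantee (M.mechanism t h) (f t h))
    (hfF : ∀ t < T, ∀ h : FDP.Hist O t, f t h ∈ F)
    (fB : FDP.TradeoffFun)
    (hmeas : FDP.MeasurableDecisions f (FDP.naturalFilter fB) T) :
    FDP.IsDP (FDP.filteredComposition M f (FDP.naturalFilter fB) T) fB := fun S S' hS =>
  ⟨FDP.le_tradeoff_filteredComposition M hT hId hchain hfF hmeas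
      fun t ht h => ((hf t ht h).1 S S' hS).1,
    FDP.le_tradeoff_filteredComposition M hT hId hchain hfF hmeas
      fun t ht h => ((hf t ht h).1 S S' hS).2⟩
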